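/- **Theorem 3.1.** Fix an integer $d\ge 1$. Let $B\subset\mathbb C^d$ be the open unit ball and $S^{2d-1}=\partial B$ the unit sphere with the Euclidean distance. For $n\ge d$ let $dV_n=\frac{n!}{(n-d)!\,\pi^d}(1-|z|^2)^{n-d}\,dV$ on $B$, let $\mathcal H_n\subset L^2(B,dV_n)$ be the generalized Bergman space of square-integrable holomorphic functions, $P_n$ the orthogonal projection onto $\mathcal H_n$, $T_{\phi,n}f=P_n(\phi f)$ the Toeplitz operator with symbol $\phi\in C(\overline B)$, $\mathcal T_n$ the $C^*$-algebra generated by these operators, and $\mathcal K(\mathcal H_n)$ the compact operators. The symbol map $\pi(T_{\phi,n}+K)=\phi|_{S^{2d-1}}$ gives the extension $0\to\mathcal K(\mathcal H_n)\to\mathcal T_n\xrightarrow{\ \pi\ }C(S^{2d-1})\to0$. For each $n\ge d$ fix an orthonormal basis $(e_j)_{j\ge1}$ of $\mathcal H_n$ (for instance an enumeration of the normalized monomials) and a unital positive linear map $\sigma:C(S^{2d-1})\to\mathcal T_n$ with $\pi\circ\sigma=\mathrm{id}$. Let $\mathrm{Lip}(\mathcal K(\mathcal H_n))$ be the set of self-adjoint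 compact operators $K$ on $\mathcal H_n$ with all $\langle Ke_i|e_j\rangle$ real and $$\tilde L_n(K)=\sup_{i,j\ge1}(i+j)^{n+2}\,|\langle Ke_i|e_j\rangle|<\infty .$$ For a real Lipschitz function $f$ on $S^{2d-1}$ let $L(f)=\sup_{x\ne y}|f(x)-f(y)|/|x-y|$. Put $$\mathrm{Lip}(\mathcal T_n)=\{\sigma(f)+K:\ f \text{ real Lipschitz on } S^{2d-1},\ K\in \mathrm{Lip}(\mathcal K(\mathcal H_n))\},\qquad L_n(\sigma(f)+K)=\tilde L_n(K)+L(f),$$ with the operator order and order unit $I$. A *Lip-norm* on an order-unit space $(A,e)$ is a finite seminorm $L$ with $L(e)=0$ such that $\rho_L(\mu,\nu)=\sup\{|\mu(a)-\nu(a)|:L(a)\le1\}$ induces the weak-$*$ topology on the state space $\mathcal S(A)$; then $(A,L)$ is a *compact quantum metric space*. The *quantum Gromov–Hausdorff distance* $\mathrm{dist}_q(A,B)$ of $(A,L_A)$ and $(B,L_B)$ is the infimum, over all Lip-norms $L$ on $A\oplus B$ whose quotient seminorms on $A$ and $B$ are $L_A$ and $L_B$, of the Hausdorff distance between $\mathcal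 S(A)$ and $\mathcal S(B)$ inside $(\mathcal S(A\oplus B),\rho_L)$. Then $(\mathrm{Lip}(\mathcal T_n),L_n)$, for each $n\ge d$, and the space of real Lipschitz functions on $S^{2d-1}$ with the seminorm $L$ are compact quantum metric spaces, and the quantum Gromov–Hausdorff distance between them tends to $0$ as $n\to\infty$. That is, $(\mathrm{Lip}(\mathcal T_n),L_n)$ converges to $C(S^{2d-1})$. -/

import Mathlib

open MeasureTheory Filter Topology
open scoped ENNReal NNReal InnerProductSpace

namespace QuantumSphere

/-! ### Order-unit spaces, Lip-norms, quantum Gromov-Hausdorff distance -/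

section OrderUnit

variable {A : Type*} [AddCommGroup A] [Module ℝ A] [PartialOrder A]

/-- `A` is an order-unit space with order unit `e`: a real partially ordered vector space in which
`e` is a (nonnegative) Archimedean order unit. -/
structure IsOrderUnitSpace (e : A) : Prop where
  add_le_add : ∀ a b c : A, a ≤ b → a + c ≤ b + c
  smul_nonneg : ∀ (r : ℝ) (a : A), 0 ≤ r → 0 ≤ a → 0 ≤ r • a
  unit_nonneg : 0 ≤ e
  order_unit : ∀ a : A, ∃ r : ℝ, a ≤ r • e
  archimedean : ∀ a : A, (∀ r : ℝ, 0 < r → a ≤ r • e) → a ≤ 0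

/-- The state space of `(A, e)`: positive real linear functionals with value `1` at `e`. -/
def StateSpace (e : A) : Type _ :=
  {μ : A →ₗ[ℝ] ℝ // (∀ a, 0 ≤ a → 0 ≤ μ a) ∧ μ e = 1}

/-- The weak-* topology on the state space (pointwise convergence on `A`). -/
@[reducible] def weakStarTopology (e : A) : TopologicalSpace (StateSpace e) :=
  TopologicalSpace.induced (fun μ (a : A) => μ.1 a) inferInstance

/-- The (extended) metric `ρ_L(μ, ν) = sup {|μ(a) - ν(a)| : L(a) ≤ 1}` on the state space. -/
@[reducible] noncomputable def stateMetric (e : A) (L : A → ℝ) :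
    PseudoEMetricSpace (StateSpace e) where
  edist μ ν := ⨆ (a : A) (_ : L a ≤ 1), edist (μ.1 a) (ν.1 a)
  edist_self μ := by simp
  edist_comm μ ν := by simp only [edist_comm]
  edist_triangle μ ν ξ := by
    refine iSup₂_le fun a ha => (edist_triangle _ (ν.1 a) _).trans ?_
    exact add_le_add (le_iSup₂ (f := fun a (_ : L a ≤ 1) => edist (μ.1 a) (ν.1 a)) a ha)
      (le_iSup₂ (f := fun a (_ : L a ≤ 1) => edist (ν.1 a) (ξ.1 a)) a ha)

/-- `L` is a Lip-norm on the order-unit space `(A, e)`: a finite seminorm, vanishing at `e`, whose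
metric on the state space induces the weak-* topology. -/
structure IsLipNorm (e : A) (L : A → ℝ) : Prop where
  add_le : ∀ a b, L (a + b) ≤ L a + L b
  smul_eq : ∀ (r : ℝ) a, L (r • a) = |r| * L a
  map_unit : L e = 0
  topology_eq : (stateMetric e L).toUniformSpace.toTopologicalSpace = weakStarTopology e

/-- `(A, e, L)` is a compact quantum metric space. -/
structure IsCompactQuantumMetricSpace (e : A) (L : A → ℝ) : Prop where
  orderUnit : IsOrderUnitSpace e
  lipNorm : IsLipNorm e L

variable {B : Type*} [AddCommGroup B] [Module ℝ B] [PartialOrder B]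

/-- States of `A` regarded as states of `A ⊕ B` (the dual of the projection `A ⊕ B → A`). -/
def StateSpace.inl {eA : A} (eB : B) (μ : StateSpace eA) : StateSpace (eA, eB) :=
  ⟨μ.1 ∘ₗ LinearMap.fst ℝ A B, fun a ha => μ.2.1 a.1 ha.1, μ.2.2⟩

/-- States of `B` regarded as states of `A ⊕ B`. -/
def StateSpace.inr (eA : A) {eB : B} (μ : StateSpace eB) : StateSpace (eA, eB) :=
  ⟨μ.1 ∘ₗ LinearMap.snd ℝ A B, fun a ha => μ.2.1 a.2 ha.2, μ.2.2⟩

/-- The set `M(L_A, L_B)` of Lip-norms on `A ⊕ B` (coordinatewise order, order unit `(e_A, e_B)`)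
that induce `L_A` and `L_B`, i.e. whose quotient seminorms on `A` and `B` are `L_A` and `L_B`. -/
def inducingLipNorms (eA : A) (LA : A → ℝ) (eB : B) (LB : B → ℝ) : Set (A × B → ℝ) :=
  {L | IsLipNorm (eA, eB) L ∧
    (∀ a, IsGLB (Set.range fun b => L (a, b)) (LA a)) ∧
    (∀ b, IsGLB (Set.range fun a => L (a, b)) (LB b))}

/-- Quantum Gromov-Hausdorff distance: the infimum over `L ∈ M(L_A, L_B)` of the Hausdorff distance
between the state spaces of `A` and `B` inside the state space of `A ⊕ B` with the metric `ρ_L`.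
It takes values in `[0, ∞]`, and is `∞` if `M(L_A, L_B)` is empty. -/
noncomputable def quantumGHDist (eA : A) (LA : A → ℝ) (eB : B) (LB : B → ℝ) : ℝ≥0∞ :=
  ⨅ L ∈ inducingLipNorms eA LA eB LB,
    @Metric.hausdorffEDist (StateSpace (eA, eB)) (stateMetric (eA, eB) L)
      (Set.range (StateSpace.inl eB)) (Set.range (StateSpace.inr eA))

end OrderUnit

/-! ### Real Lipschitz functions on a compact metric space -/

section Lipschitz

variable (X : Type*) [MetricSpace X] [CompactSpace X]

/-- The space of real-valued Lipschitz functions on `X`, ordered pointwise. -/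
def LipFun : Submodule ℝ C(X, ℝ) where
  carrier := {f | ∃ C : ℝ≥0, LipschitzWith C f}
  add_mem' := by
    rintro f g ⟨C, hC⟩ ⟨D, hD⟩
    exact ⟨C + D, hC.add hD⟩
  zero_mem' := ⟨0, LipschitzWith.const 0⟩
  smul_mem' := by
    rintro r f ⟨C, hC⟩
    refine ⟨‖r‖₊ * C, LipschitzWith.of_dist_le_mul fun x y => ?_⟩
    have := hC.dist_le_mul x y
    simp only [ContinuousMap.coe_smul, Pi.smul_apply, dist_smul₀, NNReal.coe_mul, coe_nnnorm,
      mul_assoc]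
    gcongr

variable {X}

/-- The Lipschitz seminorm `sup_{x ≠ y} |f(x) - f(y)| / d(x, y)`
(the terms with `x = y` are `0 / 0 = 0`). -/
noncomputable def lipSeminorm (f : LipFun X) : ℝ :=
  ⨆ p : X × X, |f.1 p.1 - f.1 p.2| / dist p.1 p.2

/-- The constant function `1`, the order unit of `LipFun X`. -/
def lipOne : LipFun X := ⟨1, 0, LipschitzWith.const 1⟩

end Lipschitz

/-! ### Generalized Bergman spaces -/

/-- Complex Euclidean space `ℂ^d`. -/
abbrev Cd (d : ℕ) : Type := EuclideanSpace ℂ (Fin d)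

/-- Lebesgue measure on `ℂ^d = ℝ^{2d}`. -/
noncomputable def lebesgue (d : ℕ) : Measure (Cd d) :=
  (volume : Measure (Fin d → ℂ)).map (WithLp.toLp 2)

/-- The density `c_n (1 - |z|²)^(n-d)`, `c_n = n! / ((n-d)! π^d)`. -/
noncomputable def density (d n : ℕ) (z : Cd d) : ℝ :=
  (n.factorial : ℝ) / ((n - d).factorial * Real.pi ^ d) * (1 - ‖z‖ ^ 2) ^ (n - d)

/-- The probability measure `dV_n = c_n (1 - |z|²)^(n-d) dV` on the open unit ball of `ℂ^d`. -/
noncomputable def ballMeasure (d n : ℕ) : Measure (Cd d) :=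
  ((lebesgue d).restrict (Metric.ball 0 1)).withDensity fun z => ENNReal.ofReal (density d n z)

/-- The generalized Bergman space, as a subspace of `L²(B, dV_n)`: the classes of square-integrable
functions that are holomorphic on the open unit ball. -/
noncomputable def bergman (d n : ℕ) : Submodule ℂ (Lp ℂ 2 (ballMeasure d n)) where
  carrier := {f | ∃ g : Cd d → ℂ, DifferentiableOn ℂ g (Metric.ball 0 1) ∧ f =ᵐ[ballMeasure d n] g}
  add_mem' := by
    rintro f₁ f₂ ⟨g₁, h₁, e₁⟩ ⟨g₂, h₂, e₂⟩
    exact ⟨g₁ + g₂, h₁.add h₂, (Lp.coeFn_add f₁ f₂).trans (e₁.add e₂)⟩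
  zero_mem' := ⟨0, differentiableOn_const 0, Lp.coeFn_zero _ _ _⟩
  smul_mem' := by
    rintro c f ⟨g, h, e⟩
    exact ⟨c • g, h.const_smul c, (Lp.coeFn_smul c f).trans (e.const_smul c)⟩

/-! Facts needed for the closedness of the Bergman space in `L²`. -/

instance lebesgue_isAddHaarMeasure (d : ℕ) : (lebesgue d).IsAddHaarMeasure :=
  (PiLp.continuousLinearEquiv 2 ℂ (fun _ : Fin d => ℂ)).symm.isAddHaarMeasure_map volume

theorem lebesgue_measurePreserving (d : ℕ) :
    MeasurePreserving (WithLp.toLp 2) (volume : Measure (Fin d → ℂ)) (lebesgue d) :=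
  ⟨WithLp.measurable_toLp 2 _, rfl⟩

theorem measurePreserving_rotate {d : ℕ} (c : Circle) :
    MeasurePreserving (fun z : Cd d => (c : ℂ) • z) (lebesgue d) (lebesgue d) := by
  have h1 : MeasurePreserving (fun (z : Fin d → ℂ) i => (c : ℂ) * z i) volume volume :=
    volume_preserving_pi (f := fun _ z => (c : ℂ) * z) fun i => (rotation c).measurePreserving
  refine ⟨by fun_prop, ?_⟩
  have h2 := ((lebesgue_measurePreserving d).comp h1).map_eq
  rw [lebesgue, Measure.map_map (by fun_prop) (WithLp.measurable_toLp 2 _)]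
  exact h2

/-- Mean value inequality for `|g|²`. -/
theorem sq_mul_volume_le {d : ℕ} {g : Cd d → ℂ} (hg : DifferentiableOn ℂ g (Metric.ball 0 1))
    {z : Cd d} {δ : ℝ} (hz : Metric.ball z δ ⊆ Metric.ball 0 1) :
    ‖g z‖ₑ ^ 2 * lebesgue d (Metric.ball 0 δ) ≤ ∫⁻ w in Metric.ball z δ, ‖g w‖ₑ ^ 2 ∂lebesgue d := by
  classical
  set G : Cd d → ℂ := (Metric.ball 0 1).indicator g with hG
  have hGm : Measurable G := by
    have h0 : G = (Metric.ball 0 1).piecewise g (fun _ => 0) := by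
      rw [hG, ← Set.piecewise_eq_indicator]
      rfl
    rw [h0]
    exact hg.continuousOn.measurable_piecewise continuousOn_const
      Metric.isOpen_ball.measurableSet
  set F : Cd d → ℝ≥0∞ := fun w => ‖G w‖ₑ ^ 2 with hF
  have hFm : Measurable F := by fun_prop
  have hFg : ∀ w ∈ Metric.ball z δ, F w = ‖g w‖ₑ ^ 2 := fun w hw => by
    simp [hF, hG, Set.indicator_of_mem (hz hw)]
  rw [← setLIntegral_congr_fun Metric.isOpen_ball.measurableSet hFg]
  set I : Set ℝ := Set.Ioc 0 (2 * Real.pi)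
  have hI : volume I = ENNReal.ofReal (2 * Real.pi) := by simp [I]
  have hmem : ∀ w ∈ Metric.ball (0 : Cd d) δ, ∀ t : ℂ, ‖t‖ ≤ 1 → z + t • w ∈ Metric.ball z δ := by
    intro w hw t ht
    rw [mem_ball_iff_norm, add_sub_cancel_left, norm_smul]
    rw [mem_ball_zero_iff] at hw
    exact (mul_le_of_le_one_left (norm_nonneg _) ht).trans_lt hw
  have key : ∀ w ∈ Metric.ball (0 : Cd d) δ,
      volume I * ‖g z‖ₑ ^ 2 ≤ ∫⁻ θ in I, F (z + circleMap 0 1 θ • w) := by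
    intro w hw
    have hd : DiffContOnCl ℂ (fun t : ℂ => g (z + t • w) ^ 2) (Metric.ball 0 |1|) := by
      refine DifferentiableOn.diffContOnCl ?_
      rw [abs_one, closure_ball _ one_ne_zero]
      refine DifferentiableOn.pow (hg.comp (by fun_prop) fun t ht => ?_) 2
      exact hz (hmem w hw t (by simpa using ht))
    have h1 := hd.circleAverage
    simp only [zero_smul, add_zero, Real.circleAverage] at h1
    rw [← enorm_pow, ← h1, enorm_smul, hI, ← mul_assoc,
      intervalIntegral.integral_of_le Real.two_pi_pos.le]
    have h2 : ENNReal.ofReal (2 * Real.pi) * ‖(2 * Real.pi)⁻¹‖ₑ = 1 := by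
      rw [Real.enorm_eq_ofReal (by positivity), ← ENNReal.ofReal_mul (by positivity),
        mul_inv_cancel₀ (by positivity), ENNReal.ofReal_one]
    rw [h2, one_mul]
    refine (enorm_integral_le_lintegral_enorm _).trans (lintegral_mono fun θ => ?_)
    rw [hFg _ (hmem w hw _ (by simp)), enorm_pow]
  have inner : ∀ θ : ℝ, ∫⁻ w in Metric.ball (0 : Cd d) δ, F (z + circleMap 0 1 θ • w) ∂lebesgue d
      = ∫⁻ w in Metric.ball z δ, F w ∂lebesgue d := by
    intro θ
    have hmp : MeasurePreserving (fun w : Cd d => z + circleMap 0 1 θ • w) (lebesgue d)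
        (lebesgue d) := by
      have := (measurePreserving_add_left (lebesgue d) z).comp
        (measurePreserving_rotate (d := d) (Circle.exp θ))
      simpa [Function.comp_def, circleMap] using this
    have hpre : (fun w : Cd d => z + circleMap 0 1 θ • w) ⁻¹' Metric.ball z δ = Metric.ball 0 δ := by
      ext w
      simp [norm_smul]
    rw [← hmp.setLIntegral_comp_preimage Metric.isOpen_ball.measurableSet hFm, hpre]
  have tot : volume I * (‖g z‖ₑ ^ 2 * lebesgue d (Metric.ball 0 δ)) ≤
      volume I * ∫⁻ w in Metric.ball z δ, F w ∂lebesgue d := by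
    calc volume I * (‖g z‖ₑ ^ 2 * lebesgue d (Metric.ball 0 δ))
        = ∫⁻ _ in Metric.ball (0 : Cd d) δ, volume I * ‖g z‖ₑ ^ 2 ∂lebesgue d := by
          rw [setLIntegral_const, mul_assoc]
      _ ≤ ∫⁻ w in Metric.ball (0 : Cd d) δ, (∫⁻ θ in I, F (z + circleMap 0 1 θ • w)) ∂lebesgue d :=
          setLIntegral_mono' Metric.isOpen_ball.measurableSet key
      _ = ∫⁻ θ in I, ∫⁻ w in Metric.ball (0 : Cd d) δ, F (z + circleMap 0 1 θ • w) ∂lebesgue d := by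
          refine lintegral_lintegral_swap (Measurable.aemeasurable ?_)
          refine hFm.comp ?_
          have : Continuous (circleMap 0 1) := continuous_circleMap 0 1
          fun_prop
      _ = volume I * ∫⁻ w in Metric.ball z δ, F w ∂lebesgue d := by
          simp only [inner, setLIntegral_const, mul_comm]
  have hI0 : volume I ≠ 0 := by rw [hI]; simp [Real.pi_pos]
  have hI1 : volume I ≠ ∞ := by rw [hI]; exact ENNReal.ofReal_ne_top
  exact (ENNReal.mul_le_mul_iff_right hI0 hI1).1 tot

/-- Point evaluations are bounded, uniformly on smaller balls. -/
theorem exists_eval_bound (d n : ℕ) {δ : ℝ} (hδ : 0 < δ) : ∃ C : ℝ, 0 ≤ C ∧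
    ∀ (f : Lp ℂ 2 (ballMeasure d n)) (g : Cd d → ℂ), DifferentiableOn ℂ g (Metric.ball 0 1) →
      f =ᵐ[ballMeasure d n] g → ∀ z ∈ Metric.closedBall (0 : Cd d) (1 - 2 * δ), ‖g z‖ ≤ C * ‖f‖ := by
  by_cases hδ1 : 1 < 2 * δ
  · refine ⟨0, le_rfl, fun f g _ _ z hz => absurd hz ?_⟩
    rw [Metric.closedBall_eq_empty.2 (by linarith)]
    simp
  set w0 : ℝ := (n.factorial : ℝ) / ((n - d).factorial * Real.pi ^ d) *
    (1 - (1 - δ) ^ 2) ^ (n - d)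
  have hw0 : 0 < w0 := by
    have : 0 < 1 - (1 - δ) ^ 2 := by nlinarith
    positivity
  set V := lebesgue d (Metric.ball 0 δ)
  have hV0 : V ≠ 0 := (Metric.measure_ball_pos _ _ hδ).ne'
  have hV1 : V ≠ ∞ := measure_ball_lt_top.ne
  set K : ℝ≥0∞ := (ENNReal.ofReal w0 * V)⁻¹
  have hK0 : ENNReal.ofReal w0 * V ≠ 0 := mul_ne_zero (by simpa using hw0) hV0
  have hK1 : ENNReal.ofReal w0 * V ≠ ∞ := ENNReal.mul_ne_top ENNReal.ofReal_ne_top hV1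
  have hK : K ≠ ∞ := ENNReal.inv_ne_top.2 hK0
  refine ⟨Real.sqrt K.toReal, Real.sqrt_nonneg _, fun f g hg hfg z hz => ?_⟩
  rw [mem_closedBall_zero_iff] at hz
  have hsub : Metric.ball z δ ⊆ Metric.ball 0 (1 - δ) :=
    Metric.ball_subset_ball' (by rw [dist_zero_right]; linarith)
  have hsub1 : Metric.ball (0 : Cd d) (1 - δ) ⊆ Metric.ball 0 1 :=
    Metric.ball_subset_ball (by linarith)
  have h1 := sq_mul_volume_le hg (hsub.trans hsub1)
  have hdm : Measurable fun z : Cd d => ENNReal.ofReal (density d n z) := by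
    unfold density; fun_prop
  have h2 : ENNReal.ofReal w0 * ∫⁻ w in Metric.ball z δ, ‖g w‖ₑ ^ 2 ∂lebesgue d ≤
      ∫⁻ w, ‖g w‖ₑ ^ 2 ∂ballMeasure d n := by
    rw [ballMeasure, lintegral_withDensity_eq_lintegral_mul_non_measurable _ hdm
      (Eventually.of_forall fun _ => ENNReal.ofReal_lt_top),
      ← lintegral_const_mul' _ _ ENNReal.ofReal_ne_top]
    refine (setLIntegral_mono' Metric.isOpen_ball.measurableSet fun w hw => ?_).trans
      (lintegral_mono_set (hsub.trans hsub1))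
    simp only [Pi.mul_apply]
    gcongr
    have hw' := hsub hw
    rw [mem_ball_zero_iff] at hw'
    unfold density
    have : ‖w‖ ^ 2 ≤ (1 - δ) ^ 2 := by gcongr
    have h3 : 0 ≤ 1 - (1 - δ) ^ 2 := by nlinarith
    simp only [w0]
    gcongr
  have h3 : ∫⁻ w, ‖g w‖ₑ ^ 2 ∂ballMeasure d n = ‖f‖ₑ ^ 2 := by
    have h4 : ∫⁻ w, ‖g w‖ₑ ^ 2 ∂ballMeasure d n = ∫⁻ w, ‖f w‖ₑ ^ 2 ∂ballMeasure d n :=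
      lintegral_congr_ae (hfg.mono fun w hw => by simp only [hw])
    rw [h4, Lp.enorm_def, eLpNorm_eq_lintegral_rpow_enorm_toReal (by norm_num) (by norm_num)]
    rw [← ENNReal.rpow_natCast, ← ENNReal.rpow_mul]
    simp
  have h5 : ‖g z‖ₑ ^ 2 ≤ K * ‖f‖ₑ ^ 2 := by
    rw [← h3]
    rw [mul_comm K, ← div_eq_mul_inv, ENNReal.le_div_iff_mul_le (Or.inl hK0) (Or.inl hK1)]
    calc ‖g z‖ₑ ^ 2 * (ENNReal.ofReal w0 * V) = ENNReal.ofReal w0 * (‖g z‖ₑ ^ 2 * V) := by ring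
      _ ≤ _ := (mul_le_mul_right h1 _).trans h2
  have h6 : ‖g z‖ ^ 2 ≤ K.toReal * ‖f‖ ^ 2 := by
    have := ENNReal.toReal_mono (ENNReal.mul_ne_top hK (by simp)) h5
    simpa using this
  calc ‖g z‖ = Real.sqrt (‖g z‖ ^ 2) := (Real.sqrt_sq (norm_nonneg _)).symm
    _ ≤ Real.sqrt (K.toReal * ‖f‖ ^ 2) := Real.sqrt_le_sqrt h6
    _ = _ := by rw [Real.sqrt_mul ENNReal.toReal_nonneg, Real.sqrt_sq (norm_nonneg _)]

/-- Cauchy estimate for the derivative. -/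
theorem norm_fderiv_le_of_bound {d : ℕ} {h : Cd d → ℂ}
    (hh : DifferentiableOn ℂ h (Metric.ball 0 1)) {r s M : ℝ} (hrs : r < s) (hs : s < 1)
    (hM : ∀ z ∈ Metric.closedBall (0 : Cd d) s, ‖h z‖ ≤ M) {z : Cd d}
    (hz : z ∈ Metric.closedBall (0 : Cd d) r) : ‖fderiv ℂ h z‖ ≤ M / (s - r) := by
  have hsr : 0 < s - r := sub_pos.2 hrs
  rw [mem_closedBall_zero_iff] at hz
  have hM0 : 0 ≤ M := (norm_nonneg _).trans (hM z (by rw [mem_closedBall_zero_iff]; linarith))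
  refine ContinuousLinearMap.opNorm_le_bound _ (by positivity) fun v => ?_
  rcases eq_or_ne v 0 with rfl | hv
  · simp
  have hv' : 0 < ‖v‖ := norm_pos_iff.2 hv
  have hR : 0 < (s - r) / ‖v‖ := by positivity
  have hmem : ∀ t ∈ Metric.closedBall (0 : ℂ) ((s - r) / ‖v‖),
      z + t • v ∈ Metric.closedBall (0 : Cd d) s := fun t ht => by
    rw [mem_closedBall_zero_iff] at ht ⊢
    rw [le_div_iff₀ hv'] at ht
    calc ‖z + t • v‖ ≤ ‖z‖ + ‖t‖ * ‖v‖ := (norm_add_le _ _).trans (by rw [norm_smul])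
      _ ≤ s := by linarith
  have hd : DiffContOnCl ℂ (fun t : ℂ => h (z + t • v)) (Metric.ball 0 ((s - r) / ‖v‖)) := by
    refine DifferentiableOn.diffContOnCl ?_
    rw [closure_ball _ hR.ne']
    exact hh.comp (by fun_prop) fun t ht => Metric.closedBall_subset_ball hs (hmem t ht)
  have h1 := Complex.norm_deriv_le_of_forall_mem_sphere_norm_le hR hd
    fun t ht => hM _ (hmem t (Metric.sphere_subset_closedBall ht))
  have hz1 : HasFDerivAt h (fderiv ℂ h z) (z + (0 : ℂ) • v) := by
    rw [zero_smul, add_zero]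
    exact (hh.differentiableAt (Metric.isOpen_ball.mem_nhds (by
      rw [mem_ball_zero_iff]; linarith))).hasFDerivAt
  have h2 : HasDerivAt (fun t : ℂ => z + t • v) v 0 := by
    simpa using ((hasDerivAt_id (0 : ℂ)).smul_const v).const_add z
  have h3 : deriv (fun t : ℂ => h (z + t • v)) 0 = fderiv ℂ h z v :=
    (hz1.comp_hasDerivAt 0 h2).deriv
  rw [h3] at h1
  refine h1.trans (le_of_eq ?_)
  field_simp

/-- Locally uniform limits of holomorphic functions are holomorphic. -/
theorem differentiableOn_of_uniformCauchy {d : ℕ} {F : ℕ → Cd d → ℂ} {G : Cd d → ℂ}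
    (hF : ∀ k, DifferentiableOn ℂ (F k) (Metric.ball 0 1))
    (hc : ∀ r < 1, UniformCauchySeqOn F atTop (Metric.closedBall (0 : Cd d) r))
    (hG : ∀ z ∈ Metric.ball (0 : Cd d) 1, Tendsto (fun k => F k z) atTop (𝓝 (G z))) :
    DifferentiableOn ℂ G (Metric.ball 0 1) := by
  intro z hz
  rw [mem_ball_zero_iff] at hz
  obtain ⟨r, hzr, hr1⟩ := exists_between hz
  obtain ⟨s, hrs, hs1⟩ := exists_between hr1
  have hsub : Metric.ball (0 : Cd d) r ⊆ Metric.ball 0 1 := Metric.ball_subset_ball hr1.le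
  have hcd : UniformCauchySeqOn (fun k => fderiv ℂ (F k)) atTop (Metric.ball (0 : Cd d) r) := by
    rw [Metric.uniformCauchySeqOn_iff]
    intro ε hε
    have hsr : 0 < s - r := sub_pos.2 hrs
    obtain ⟨N, hN⟩ := Metric.uniformCauchySeqOn_iff.1 (hc s hs1) (ε / 2 * (s - r)) (by positivity)
    refine ⟨N, fun m hm k hk x hx => ?_⟩
    have hx1 := Metric.isOpen_ball.mem_nhds (hsub hx)
    rw [dist_eq_norm, ← fderiv_sub ((hF m).differentiableAt hx1) ((hF k).differentiableAt hx1)]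
    have := norm_fderiv_le_of_bound ((hF m).sub (hF k)) hrs hs1
      (M := ε / 2 * (s - r)) (fun y hy => by
        have := hN m hm k hk y hy
        rw [dist_eq_norm] at this
        exact this.le) (Metric.ball_subset_closedBall hx)
    rw [mul_div_cancel_right₀ _ hsr.ne'] at this
    linarith
  have hlim : ∀ x, ∃ y, x ∈ Metric.ball (0 : Cd d) r →
      Tendsto (fun k => fderiv ℂ (F k) x) atTop (𝓝 y) := by
    intro x
    by_cases hx : x ∈ Metric.ball (0 : Cd d) r
    · obtain ⟨y, hy⟩ := cauchySeq_tendsto_of_complete (hcd.cauchySeq hx)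
      exact ⟨y, fun _ => hy⟩
    · exact ⟨0, fun h => absurd h hx⟩
  choose G' hG' using hlim
  have := hasFDerivAt_of_tendstoUniformlyOn Metric.isOpen_ball
    (hcd.tendstoUniformlyOn_of_tendsto hG')
    (fun k x hx => ((hF k).differentiableAt
      (Metric.isOpen_ball.mem_nhds (hsub hx))).hasFDerivAt) (fun x hx => hG x (hsub hx))
    (by rwa [mem_ball_zero_iff] : z ∈ Metric.ball (0 : Cd d) r)
  exact this.differentiableAt.differentiableWithinAt

theorem bergman_isClosed (d n : ℕ) : IsClosed (bergman d n : Set (Lp ℂ 2 (ballMeasure d n))) := by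
  refine IsSeqClosed.isClosed fun f f₀ hf hlim => ?_
  choose g hg hfg using hf
  have hc : ∀ r < 1, UniformCauchySeqOn g atTop (Metric.closedBall (0 : Cd d) r) := by
    intro r hr
    obtain ⟨C, hC0, hC⟩ := exists_eval_bound d n (δ := (1 - r) / 2) (by linarith)
    rw [show 1 - 2 * ((1 - r) / 2) = r by ring] at hC
    rw [Metric.uniformCauchySeqOn_iff]
    intro ε hε
    obtain ⟨N, hN⟩ := Metric.cauchySeq_iff.1 hlim.cauchySeq (ε / (C + 1)) (by positivity)
    refine ⟨N, fun m hm k hk z hz => ?_⟩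
    have h1 := hC (f m - f k) (g m - g k) ((hg m).sub (hg k))
      ((Lp.coeFn_sub _ _).trans ((hfg m).sub (hfg k))) z hz
    have h2 := hN m hm k hk
    rw [dist_eq_norm, lt_div_iff₀ (by positivity)] at h2
    rw [dist_eq_norm]
    calc ‖g m z - g k z‖ ≤ C * ‖f m - f k‖ := h1
      _ ≤ ‖f m - f k‖ * (C + 1) := by nlinarith [norm_nonneg (f m - f k)]
      _ < ε := h2
  have hpt : ∀ z, ∃ y, z ∈ Metric.ball (0 : Cd d) 1 →
      Tendsto (fun k => g k z) atTop (𝓝 y) := by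
    intro z
    by_cases hz : z ∈ Metric.ball (0 : Cd d) 1
    · obtain ⟨y, hy⟩ := cauchySeq_tendsto_of_complete
        ((hc ‖z‖ (by simpa using hz)).cauchySeq (x := z) (by simp))
      exact ⟨y, fun _ => hy⟩
    · exact ⟨0, fun h => absurd h hz⟩
  choose G hG using hpt
  refine ⟨G, differentiableOn_of_uniformCauchy hg hc hG, ?_⟩
  obtain ⟨ψ, hψ, hae⟩ := (tendstoInMeasure_of_tendsto_Lp hlim).exists_seq_tendsto_ae
  have hball : ∀ᵐ z ∂ballMeasure d n, z ∈ Metric.ball (0 : Cd d) 1 :=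
    (withDensity_absolutelyContinuous _ _).ae_le
      (ae_restrict_mem Metric.isOpen_ball.measurableSet)
  filter_upwards [hae, hball, ae_all_iff.2 hfg] with z h1 h2 h3
  refine tendsto_nhds_unique h1 ?_
  simp only [h3]
  exact (hG z h2).comp hψ.tendsto_atTop

/-- The generalized Bergman space `H_n` as a Hilbert space. -/
def Bergman (d n : ℕ) : Type := bergman d n

noncomputable instance (d n : ℕ) : NormedAddCommGroup (Bergman d n) :=
  inferInstanceAs (NormedAddCommGroup (bergman d n))

noncomputable instance (d n : ℕ) : InnerProductSpace ℂ (Bergman d n) :=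
  inferInstanceAs (InnerProductSpace ℂ (bergman d n))

instance (d n : ℕ) : CompleteSpace (bergman d n) :=
  (bergman_isClosed d n).completeSpace_coe

instance (d n : ℕ) : CompleteSpace (Bergman d n) :=
  inferInstanceAs (CompleteSpace (bergman d n))

/-- The inclusion `H_n → L²(B, dV_n)`. -/
noncomputable def incl (d n : ℕ) : Bergman d n →L[ℂ] Lp ℂ 2 (ballMeasure d n) :=
  (bergman d n).subtypeL

/-- The orthogonal projection `P_n : L²(B, dV_n) → H_n`. -/
noncomputable def proj (d n : ℕ) : Lp ℂ 2 (ballMeasure d n) →L[ℂ] Bergman d n :=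
  (bergman d n).orthogonalProjectionOnto

/-! ### Toeplitz operators -/

/-- The closed unit ball of `ℂ^d`. -/
abbrev CBall (d : ℕ) : Type := Metric.closedBall (0 : Cd d) 1

/-- The unit sphere `S^{2d-1}` of `ℂ^d`, with the Euclidean distance. -/
abbrev Sph (d : ℕ) : Type := Metric.sphere (0 : Cd d) 1

open Classical in
/-- A function on the closed ball, extended by zero. -/
noncomputable def extendZero {d : ℕ} (u : C(CBall d, ℂ)) (z : Cd d) : ℂ :=
  if h : z ∈ Metric.closedBall (0 : Cd d) 1 then u ⟨z, h⟩ else 0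

theorem memLp_extendZero {d : ℕ} (n : ℕ) (u : C(CBall d, ℂ)) :
    MemLp (extendZero u) ∞ (ballMeasure d n) := by
  classical
  have hm : Measurable (extendZero u) := by
    unfold extendZero
    exact Measurable.dite (s := Metric.closedBall (0 : Cd d) 1) u.continuous.measurable
      measurable_const Metric.isClosed_closedBall.measurableSet
  refine memLp_top_of_bound hm.aestronglyMeasurable ‖u‖ (Eventually.of_forall fun z => ?_)
  unfold extendZero
  split_ifs with h
  · exact u.norm_coe_le_norm ⟨z, h⟩
  · simp

/-- Multiplication by `u` on `L²(B, dV_n)`. -/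
noncomputable def mulOp {d : ℕ} (n : ℕ) (u : C(CBall d, ℂ)) :
    Lp ℂ 2 (ballMeasure d n) →L[ℂ] Lp ℂ 2 (ballMeasure d n) :=
  (ContinuousLinearMap.mul ℂ ℂ).holderL (ballMeasure d n) ∞ 2 2 ((memLp_extendZero n u).toLp _)

/-- The Toeplitz operator `T_{u,n} f = P_n (u f)`. -/
noncomputable def toeplitz {d : ℕ} (n : ℕ) (u : C(CBall d, ℂ)) : Bergman d n →L[ℂ] Bergman d n :=
  proj d n ∘L mulOp n u ∘L incl d n

/-- The Toeplitz algebra: the C*-algebra generated by the Toeplitz operators with continuous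
symbol. -/
noncomputable def toeplitzAlgebra (d n : ℕ) : StarSubalgebra ℂ (Bergman d n →L[ℂ] Bergman d n) :=
  (StarAlgebra.adjoin ℂ (Set.range (toeplitz (d := d) n))).topologicalClosure

/-- The restriction of a function on the closed ball to the sphere. -/
noncomputable def restrictSphere {d : ℕ} (u : C(CBall d, ℂ)) : C(Sph d, ℂ) :=
  ⟨fun x => u ⟨x.1, Metric.sphere_subset_closedBall x.2⟩, by fun_prop⟩

/-- The graph of the symbol map `π`, `π (T_u + K) = u|_S`: the operator `T` is of the form `T_u + K`
with `K` compact and `u|_S = f`. -/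
def HasSymbol {d n : ℕ} (T : Bergman d n →L[ℂ] Bergman d n) (f : C(Sph d, ℂ)) : Prop :=
  ∃ (u : C(CBall d, ℂ)) (K : Bergman d n →L[ℂ] Bergman d n),
    IsCompactOperator K ∧ T = toeplitz n u + K ∧ restrictSphere u = f

/-- A real function seen as a complex function. -/
noncomputable def complexify {X : Type*} [TopologicalSpace X] (f : C(X, ℝ)) : C(X, ℂ) :=
  ⟨fun x => (f x : ℂ), by fun_prop⟩

/-- A unital positive linear splitting `σ : C(S^{2d-1}) → 𝒯_n` of the extension
`0 → 𝒦 → 𝒯_n → C(S^{2d-1}) → 0`, i.e. `π (σ f) = f` for all `f`. -/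
structure PositiveSplitting (d n : ℕ) where
  toLinearMap : C(Sph d, ℂ) →ₗ[ℂ] toeplitzAlgebra d n
  map_one : toLinearMap 1 = 1
  positive : ∀ f : C(Sph d, ℝ), (∀ x, 0 ≤ f x) →
    (toLinearMap (complexify f) : Bergman d n →L[ℂ] Bergman d n).IsPositive
  splits : ∀ f, HasSymbol (toLinearMap f : Bergman d n →L[ℂ] Bergman d n) f

/-- `σ(f)` as an operator, for real `f`. -/
noncomputable def PositiveSplitting.op {d n : ℕ} (σ : PositiveSplitting d n) (f : C(Sph d, ℝ)) :
    Bergman d n →L[ℂ] Bergman d n :=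
  (σ.toLinearMap (complexify f) : Bergman d n →L[ℂ] Bergman d n)

theorem PositiveSplitting.op_add {d n : ℕ} (σ : PositiveSplitting d n) (f g : C(Sph d, ℝ)) :
    σ.op (f + g) = σ.op f + σ.op g := by
  have : complexify (f + g) = complexify f + complexify g := by
    ext x; simp [complexify]
  simp [PositiveSplitting.op, this]

theorem PositiveSplitting.op_smul {d n : ℕ} (σ : PositiveSplitting d n) (r : ℝ)
    (f : C(Sph d, ℝ)) : σ.op (r • f) = r • σ.op f := by
  have : complexify (r • f) = (r : ℂ) • complexify f := by
    ext x; simp [complexify]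
  rw [PositiveSplitting.op, this, map_smul]
  rfl

theorem PositiveSplitting.op_one {d n : ℕ} (σ : PositiveSplitting d n) : σ.op 1 = 1 := by
  have : complexify (1 : C(Sph d, ℝ)) = 1 := by
    ext x; simp [complexify]
  rw [PositiveSplitting.op, this, σ.map_one]
  rfl

/-! ### The compact quantum metric space structure on the Toeplitz algebra -/

section

variable {H : Type*} [NormedAddCommGroup H] [InnerProductSpace ℂ H] [CompleteSpace H]
  (N : ℕ) (e : HilbertBasis ℕ ℂ H)

/-- The weighted matrix entry `(i+j)^N |⟨K e_i | e_j⟩|`. With the basis numbered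
`e_1, e_2, …`, the vector `e i` is number `i + 1`, so that `i + j` becomes `(i + 1) + (j + 1)`. -/
noncomputable def weightedEntry (K : H →L[ℂ] H) (p : ℕ × ℕ) : ℝ :=
  (((p.1 + 1) + (p.2 + 1) : ℕ) : ℝ) ^ N * ‖⟪e p.2, K (e p.1)⟫_ℂ‖

/-- `Lip(𝒦(H))`: self-adjoint compact operators with real matrix entries and finite
`sup (i+j)^N |⟨K e_i | e_j⟩|`. -/
noncomputable def lipCompact : Submodule ℝ (H →L[ℂ] H) where
  carrier := {K | IsCompactOperator K ∧ IsSelfAdjoint K ∧ (∀ i j, (⟪e j, K (e i)⟫_ℂ).im = 0) ∧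
    BddAbove (Set.range (weightedEntry N e K))}
  add_mem' := by
    rintro K₁ K₂ ⟨h₁, s₁, r₁, C₁, b₁⟩ ⟨h₂, s₂, r₂, C₂, b₂⟩
    refine ⟨h₁.add h₂, s₁.add s₂, fun i j => by
      rw [add_apply, inner_add_right, Complex.add_im, r₁, r₂, add_zero], C₁ + C₂, ?_⟩
    rintro _ ⟨p, rfl⟩
    have h1 := b₁ ⟨p, rfl⟩
    have h2 := b₂ ⟨p, rfl⟩
    refine le_trans ?_ (add_le_add h1 h2)
    simp only [weightedEntry, ← mul_add, add_apply, inner_add_right]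
    gcongr
    exact norm_add_le _ _
  zero_mem' := by
    refine ⟨isCompactOperator_zero, IsSelfAdjoint.zero _, by simp, 0, ?_⟩
    rintro _ ⟨p, rfl⟩
    simp [weightedEntry]
  smul_mem' := by
    rintro r K ⟨h, s, t, C, b⟩
    have key : ∀ i j, ⟪e j, (r • K) (e i)⟫_ℂ = r * ⟪e j, K (e i)⟫_ℂ := fun i j => by
      have : (r • K) (e i) = (r : ℂ) • K (e i) := rfl
      rw [this, inner_smul_right]
    refine ⟨h.smul r, (IsSelfAdjoint.all r).smul s, fun i j => by
      rw [key, Complex.im_ofReal_mul, t, mul_zero], |r| * C, ?_⟩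
    rintro _ ⟨p, rfl⟩
    have h1 := b ⟨p, rfl⟩
    have : weightedEntry N e (r • K) p = |r| * weightedEntry N e K p := by
      simp only [weightedEntry, key, norm_mul, Complex.norm_real, Real.norm_eq_abs]
      ring
    rw [this]
    gcongr

/-- `L̃(K) = sup (i+j)^N |⟨K e_i | e_j⟩|`. -/
noncomputable def compactSeminorm (K : H →L[ℂ] H) : ℝ :=
  ⨆ p : ℕ × ℕ, weightedEntry N e K p

end

section

variable {d n : ℕ} (e : HilbertBasis ℕ ℂ (Bergman d n)) (σ : PositiveSplitting d n)

/-- `Lip(𝒯_n) = Lip(𝒦(H_n)) ⊕ {σ(f) : f a real Lipschitz function on S^{2d-1}}`, a real space of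
self-adjoint operators, with the order of operators. -/
noncomputable def lipToeplitz : Submodule ℝ (Bergman d n →L[ℂ] Bergman d n) where
  carrier := {T | ∃ f : LipFun (Sph d), ∃ K ∈ lipCompact (n + 2) e, T = σ.op f.1 + K}
  add_mem' := by
    rintro _ _ ⟨f, K, hK, rfl⟩ ⟨g, K', hK', rfl⟩
    refine ⟨f + g, K + K', add_mem hK hK', ?_⟩
    rw [show (f + g).1 = f.1 + g.1 from rfl, σ.op_add]
    abel
  zero_mem' := by
    refine ⟨0, 0, zero_mem _, ?_⟩
    have := σ.op_smul 0 0
    rw [zero_smul, zero_smul] at this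
    rw [show (0 : LipFun (Sph d)).1 = 0 from rfl, this, add_zero]
  smul_mem' := by
    rintro r _ ⟨f, K, hK, rfl⟩
    refine ⟨r • f, r • K, Submodule.smul_mem _ r hK, ?_⟩
    rw [show (r • f).1 = r • f.1 from rfl, σ.op_smul, smul_add]

/-- `L_n(σ(f) + K) = L̃_n(K) + L(f)`. The decomposition of an element of `Lip(𝒯_n)` is unique, so
that the infimum below is over a single number. -/
noncomputable def toeplitzSeminorm (T : lipToeplitz e σ) : ℝ :=
  sInf {r | ∃ f : LipFun (Sph d), ∃ K ∈ lipCompact (n + 2) e,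
    T.1 = σ.op f.1 + K ∧ r = compactSeminorm (n + 2) e K + lipSeminorm f}

/-- The identity operator, the order unit of `Lip(𝒯_n)`. -/
noncomputable def toeplitzOne : lipToeplitz e σ :=
  ⟨1, lipOne, 0, zero_mem _, by
    rw [show (lipOne : LipFun (Sph d)).1 = 1 from rfl, σ.op_one, add_zero]⟩

end

end QuantumSphere

/-!
The map `π : σ(f) + K ↦ f` compares `Lip(𝒯_n)` with the Lipschitz functions on the sphere, and
everything rests on two facts about it.

First, `π` is well defined, unital and positive (`HasSymbol.unique`, `symbolMap_nonneg`). For a point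
`ζ` of the sphere, the normalized powers `x_k` of the function `(1 + ⟨z, ζ⟩) / 2`, which peaks at
`ζ`, have all their mass concentrating at `ζ`. Hence `⟨x_k, T_u x_k⟩ → u(ζ)`, while `x_k → 0`
weakly, so that `⟨x_k, K x_k⟩ → 0` for compact `K`: the symbol of `T` at `ζ` is the limit of
`⟨x_k, T x_k⟩` (`HasSymbol.tendsto_inner`).

Second, since `i + j ≥ 2` and `(i + j)² ≥ i j`, the Hilbert–Schmidt norm gives
`‖K‖ ≤ C 2⁻ⁿ L̃_n(K)` with `C` independent of `n` (`norm_le_compactSeminorm`). In the same way the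
operators with `L̃_n(K) ≤ 1` form a norm totally bounded set (`exists_finset_lipCompact`). Together
with the Arzelà–Ascoli theorem for Lipschitz functions and Rieffel's criterion
(`IsLipNorm.of_hasFiniteNets`), this yields the Lip-norm property.

For the distance, take `max (L_n(T), L(g), ‖π(T) - g‖ / ε)` with `ε = C 2⁻ⁿ` on the direct sum.
It induces `L_n` and `L`, because `σ` is a section of `π` and both maps are contractive for the
Lip-norms. A state `φ` of `Lip(𝒯_n)` is `2ε`-close to `φ ∘ σ`, and a state `μ` on the sphere is
`ε`-close to `μ ∘ π`, so the distance is at most `2ε` (`quantumGHDist_le_of_section`).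
-/

namespace QuantumSphere

/-! ### A total boundedness criterion for Lip-norms -/

/-- A totally bounded image has finite nets with points in the domain. -/
theorem exists_finset_dist_image_lt {V M : Type*} [Nonempty V] [PseudoMetricSpace M] {J : V → M} {S : Set V}
    (h : TotallyBounded (J '' S)) {ε : ℝ} (hε : 0 < ε) :
    ∃ F : Finset V, (∀ g ∈ F, g ∈ S) ∧ ∀ f ∈ S, ∃ g ∈ F, dist (J f) (J g) < ε := by
  classical
  obtain ⟨t, htS, htf, ht⟩ := Metric.finite_approx_of_totallyBounded h ε hε
  choose! q hqS hq using fun y (hy : y ∈ t) => htS hy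
  refine ⟨htf.toFinset.image q, fun g hg => ?_, fun f hf => ?_⟩
  · obtain ⟨y, hy, rfl⟩ := Finset.mem_image.1 hg
    exact hqS y (htf.mem_toFinset.1 hy)
  · obtain ⟨y, hy, hfy⟩ := Set.mem_iUnion₂.1 (ht ⟨f, hf, rfl⟩)
    refine ⟨q y, Finset.mem_image_of_mem _ (htf.mem_toFinset.2 hy), ?_⟩
    rw [hq y hy]
    exact hfy

section OrderUnit

variable {A : Type*} [AddCommGroup A] [Module ℝ A] [PartialOrder A]

/-- `-ε e ≤ a ≤ ε e`, i.e. the order-unit norm of `a` with respect to `e` is at most `ε`. -/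
def OrderBounded (e : A) (ε : ℝ) (a : A) : Prop :=
  0 ≤ ε • e - a ∧ 0 ≤ ε • e + a

/-- Total boundedness modulo `ℝ e` of the unit ball of the seminorm `L`, with respect to the
order-unit norm. -/
def HasFiniteNets (e : A) (L : A → ℝ) : Prop :=
  ∀ ε : ℝ, 0 < ε → ∃ F : Finset A, ∀ a, L a ≤ 1 → ∃ b ∈ F, ∃ r : ℝ,
    OrderBounded e ε (a - b - r • e)

theorem IsOrderUnitSpace.isOrderedAddMonoid {e : A} (h : IsOrderUnitSpace e) :
    IsOrderedAddMonoid A where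
  add_le_add_left a b hab c := h.add_le_add a b c hab

theorem OrderBounded.neg {e : A} {ε : ℝ} {a : A} (ha : OrderBounded e ε a) :
    OrderBounded e ε (-a) :=
  ⟨by simpa using ha.2, by simpa [sub_eq_add_neg] using ha.1⟩

theorem OrderBounded.add {e : A} (he : IsOrderUnitSpace e) {ε δ : ℝ} {a b : A}
    (ha : OrderBounded e ε a) (hb : OrderBounded e δ b) : OrderBounded e (ε + δ) (a + b) := by
  have := he.isOrderedAddMonoid
  refine ⟨(add_nonneg ha.1 hb.1).trans_eq ?_, (add_nonneg ha.2 hb.2).trans_eq ?_⟩ <;> module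

theorem OrderBounded.mono {e : A} (he : IsOrderUnitSpace e) {ε δ : ℝ} {a : A}
    (ha : OrderBounded e ε a) (h : ε ≤ δ) : OrderBounded e δ a := by
  have := he.isOrderedAddMonoid
  have h1 : 0 ≤ (δ - ε) • e := he.smul_nonneg _ _ (sub_nonneg.2 h) he.unit_nonneg
  refine ⟨(add_nonneg ha.1 h1).trans_eq ?_, (add_nonneg ha.2 h1).trans_eq ?_⟩ <;> module

theorem OrderBounded.smul_unit {e : A} (he : IsOrderUnitSpace e) {ε r : ℝ} (h : |r| ≤ ε) :
    OrderBounded e ε (r • e) := by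
  rw [abs_le] at h
  exact ⟨by rw [← sub_smul]; exact he.smul_nonneg _ _ (by linarith) he.unit_nonneg,
    by rw [← add_smul]; exact he.smul_nonneg _ _ (by linarith) he.unit_nonneg⟩

theorem OrderBounded.map {B : Type*} [AddCommGroup B] [Module ℝ B] [PartialOrder B] {e : A} {e' : B}
    {p : A →ₗ[ℝ] B} (hp : ∀ a, 0 ≤ a → 0 ≤ p a) (hp1 : p e = e') {ε : ℝ} {a : A}
    (ha : OrderBounded e ε a) : OrderBounded e' ε (p a) := by
  subst hp1
  exact ⟨by simpa using hp _ ha.1, by simpa using hp _ ha.2⟩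

theorem OrderBounded.abs_state_le {e : A} {ε : ℝ} {a : A} (ha : OrderBounded e ε a)
    (μ : StateSpace e) : |μ.1 a| ≤ ε := by
  have h1 := μ.2.1 _ ha.1
  have h2 := μ.2.1 _ ha.2
  simp only [map_sub, map_add, map_smul, μ.2.2, smul_eq_mul, mul_one] at h1 h2
  rw [abs_le]
  constructor <;> linarith

/-- Every element has finite `L`, so evaluation at it is Lipschitz for `ρ_L`. The factor
`max (L a) 1` avoids dividing by `L a = 0`. -/
theorem edist_state_le {e : A} {L : A → ℝ} (smul_eq : ∀ (r : ℝ) a, L (r • a) = |r| * L a)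
    (a : A) (μ ν : StateSpace e) :
    edist (μ.1 a) (ν.1 a) ≤ ((max (L a) 1).toNNReal : ℝ≥0∞) *
      (stateMetric e L).toEDist.edist μ ν := by
  set c : ℝ := max (L a) 1
  have hc : 0 < c := lt_max_of_lt_right one_pos
  have h1 : L (c⁻¹ • a) ≤ 1 := by
    rw [smul_eq, abs_of_pos (inv_pos.2 hc), inv_mul_le_one₀ hc]
    exact le_max_left _ _
  have h2 : edist (μ.1 (c⁻¹ • a)) (ν.1 (c⁻¹ • a)) ≤ (stateMetric e L).toEDist.edist μ ν :=
    le_iSup₂ (f := fun a (_ : L a ≤ 1) => edist (μ.1 a) (ν.1 a)) _ h1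
  have h3 : edist (μ.1 a) (ν.1 a) =
      (c.toNNReal : ℝ≥0∞) * edist (μ.1 (c⁻¹ • a)) (ν.1 (c⁻¹ • a)) := by
    have h4 (m : StateSpace e) : m.1 a = c • m.1 (c⁻¹ • a) := by
      rw [map_smul, smul_inv_smul₀ hc.ne']
    rw [h4 μ, h4 ν, edist_smul₀, ENNReal.smul_def, smul_eq_mul]
    congr 2
    rw [Real.nnnorm_of_nonneg hc.le, Real.toNNReal_of_nonneg hc.le]
  rw [h3]
  gcongr

/-- Rieffel's criterion: a seminorm vanishing at the order unit is a Lip-norm if its unit ball is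
totally bounded modulo the order unit. -/
theorem IsLipNorm.of_hasFiniteNets {e : A} {L : A → ℝ} (add_le : ∀ a b, L (a + b) ≤ L a + L b)
    (smul_eq : ∀ (r : ℝ) a, L (r • a) = |r| * L a) (map_unit : L e = 0)
    (nets : HasFiniteNets e L) : IsLipNorm e L where
  add_le := add_le
  smul_eq := smul_eq
  map_unit := map_unit
  topology_eq := by
    refine le_antisymm ?_ ?_
    · rw [← continuous_iff_le_induced]
      let := stateMetric e L
      refine continuous_pi fun a => ?_
      exact LipschitzWith.continuous (K := (max (L a) 1).toNNReal) fun μ ν =>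
        edist_state_le smul_eq a μ ν
    · refine le_of_nhds_le_nhds fun μ => ?_
      let := stateMetric e L
      refine (Metric.nhds_basis_eball (x := μ)).ge_iff.2 fun ε hε => ?_
      obtain ⟨δ, hδ, hδε⟩ := ENNReal.lt_iff_exists_nnreal_btwn.1 hε
      have hδ' : (0 : ℝ) < δ / 3 := by
        have : (0 : ℝ≥0) < δ := by exact_mod_cast hδ
        positivity
      obtain ⟨F, hF⟩ := nets (δ / 3) hδ'
      have hU : ∀ᶠ ν in @nhds _ (weakStarTopology e) μ, ∀ b ∈ F, |ν.1 b - μ.1 b| ≤ δ / 3 := by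
        rw [nhds_induced, eventually_comap]
        have : ∀ᶠ f in 𝓝 (fun a => μ.1 a), ∀ b ∈ F, |f b - μ.1 b| ≤ δ / 3 := by
          refine F.eventually_all.2 fun b _ => ?_
          have := (continuous_apply (A := fun _ : A => ℝ) b).tendsto (fun a => μ.1 a)
          filter_upwards [this (Metric.closedBall_mem_nhds _ hδ')] with f hf
          exact hf
        filter_upwards [this] with f hf ν hν b hb
        simpa [← hν] using hf b hb
      filter_upwards [hU] with ν hν
      refine lt_of_le_of_lt ?_ hδε
      refine iSup₂_le fun a ha => ?_
      obtain ⟨b, hb, r, hr⟩ := hF a ha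
      have h1 := hr.abs_state_le μ
      have h2 := hr.abs_state_le ν
      have h3 := hν b hb
      simp only [map_sub, map_smul, μ.2.2, ν.2.2, smul_eq_mul, mul_one] at h1 h2
      rw [edist_dist, Real.dist_eq, ← ENNReal.ofReal_coe_nnreal]
      refine ENNReal.ofReal_le_ofReal ?_
      rw [abs_le] at *
      constructor <;> linarith [h1.1, h1.2, h2.1, h2.2, h3.1, h3.2]

end OrderUnit

/-! ### Real Lipschitz functions -/

section Lipschitz

variable {X : Type*} [MetricSpace X]

theorem isOrderUnitSpace_lipFun [CompactSpace X] : IsOrderUnitSpace (lipOne : LipFun X) where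
  add_le_add a b c h x := by simpa using h x
  smul_nonneg r a hr ha x := mul_nonneg hr (ha x)
  unit_nonneg x := zero_le_one
  order_unit a := ⟨‖a.1‖, fun x => by
    simpa [lipOne] using (le_abs_self _).trans (a.1.norm_coe_le_norm x)⟩
  archimedean a h x := le_of_forall_pos_le_add fun r hr => by
    simpa [lipOne] using h r hr x

theorem orderBounded_lipOne_iff {ε : ℝ} {f : LipFun X} :
    OrderBounded lipOne ε f ↔ ∀ x, |f.1 x| ≤ ε := by
  simp only [abs_le, forall_and]
  constructor
  · intro h
    refine ⟨fun x => ?_, fun x => ?_⟩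
    · have : 0 ≤ ε * 1 + f.1 x := h.2 x
      linarith
    · have : 0 ≤ ε * 1 - f.1 x := h.1 x
      linarith
  · intro h
    refine ⟨fun x => ?_, fun x => ?_⟩
    · change 0 ≤ ε * 1 - f.1 x
      linarith [h.2 x]
    · change 0 ≤ ε * 1 + f.1 x
      linarith [h.1 x]

theorem bddAbove_lipQuotient (f : LipFun X) :
    BddAbove (Set.range fun p : X × X => |f.1 p.1 - f.1 p.2| / dist p.1 p.2) := by
  obtain ⟨C, hC⟩ := f.2
  refine ⟨C, ?_⟩
  rintro _ ⟨p, rfl⟩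
  exact div_le_of_le_mul₀ dist_nonneg C.2 (hC.dist_le_mul p.1 p.2)

theorem abs_sub_le_lipSeminorm (f : LipFun X) (x y : X) :
    |f.1 x - f.1 y| ≤ lipSeminorm f * dist x y := by
  rcases eq_or_ne x y with rfl | h
  · simp
  · rw [← div_le_iff₀ (dist_pos.2 h)]
    exact le_ciSup (bddAbove_lipQuotient f) (x, y)

theorem lipSeminorm_nonneg (f : LipFun X) : 0 ≤ lipSeminorm f :=
  Real.iSup_nonneg fun _ => by positivity

theorem lipSeminorm_add_le (f g : LipFun X) :
    lipSeminorm (f + g) ≤ lipSeminorm f + lipSeminorm g := by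
  refine Real.iSup_le (fun p => ?_) (add_nonneg (lipSeminorm_nonneg f) (lipSeminorm_nonneg g))
  refine (?_ : _ ≤ |f.1 p.1 - f.1 p.2| / dist p.1 p.2 + |g.1 p.1 - g.1 p.2| / dist p.1 p.2).trans
    (add_le_add (le_ciSup (bddAbove_lipQuotient f) p) (le_ciSup (bddAbove_lipQuotient g) p))
  rw [← add_div]
  gcongr
  change |f.1 p.1 + g.1 p.1 - (f.1 p.2 + g.1 p.2)| ≤ _
  rw [add_sub_add_comm]
  exact abs_add_le _ _

theorem lipSeminorm_smul (r : ℝ) (f : LipFun X) : lipSeminorm (r • f) = |r| * lipSeminorm f := by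
  rw [lipSeminorm, lipSeminorm, Real.mul_iSup_of_nonneg (abs_nonneg r)]
  congr 1
  ext p
  change |r * f.1 p.1 - r * f.1 p.2| / _ = _
  rw [← mul_sub, abs_mul, mul_div_assoc]

theorem lipSeminorm_one : lipSeminorm (lipOne : LipFun X) = 0 := by
  simp [lipSeminorm, lipOne]

/-- Arzelà–Ascoli: the functions of Lipschitz constant at most `1` form a totally bounded set
modulo constants. -/
theorem hasFiniteNets_lipFun [CompactSpace X] [Nonempty X] :
    HasFiniteNets (lipOne : LipFun X) lipSeminorm := by
  intro ε hε
  obtain ⟨x₀⟩ := ‹Nonempty X›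
  set D := Metric.diam (Set.univ : Set X)
  have hD : ∀ x y : X, dist x y ≤ D := fun x y =>
    Metric.dist_le_diam_of_mem isCompact_univ.isBounded (Set.mem_univ _) (Set.mem_univ _)
  let S : Set (LipFun X) := {f | lipSeminorm f ≤ 1 ∧ f.1 x₀ = 0}
  let J : LipFun X → BoundedContinuousFunction X ℝ := fun f =>
    BoundedContinuousFunction.mkOfCompact f.1
  have hlip : ∀ f ∈ S, ∀ x y, |f.1 x - f.1 y| ≤ dist x y := fun f hf x y =>
    (abs_sub_le_lipSeminorm f x y).trans (mul_le_of_le_one_left dist_nonneg hf.1)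
  have htb : TotallyBounded (J '' S) := by
    refine (BoundedContinuousFunction.arzela_ascoli (Metric.closedBall (0 : ℝ) D)
      (isCompact_closedBall _ _) (J '' S) ?_ ?_).totallyBounded.subset subset_closure
    · rintro _ x ⟨f, hf, rfl⟩
      have := hlip f hf x x₀
      rw [hf.2, sub_zero] at this
      simpa [J] using this.trans (hD _ _)
    · refine Metric.equicontinuous_of_continuity_modulus id continuous_id.continuousAt _ ?_
      rintro x y ⟨_, f, hf, rfl⟩
      exact hlip f hf x y
  obtain ⟨F, -, hF⟩ := exists_finset_dist_image_lt htb hε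
  refine ⟨F, fun f hf => ?_⟩
  have hf₀ : f - f.1 x₀ • lipOne ∈ S := by
    refine ⟨?_, ?_⟩
    · refine (Real.iSup_le (fun p => ?_) zero_le_one : lipSeminorm (f - f.1 x₀ • lipOne) ≤ 1)
      refine le_trans ?_ ((le_ciSup (bddAbove_lipQuotient f) p).trans hf)
      change |(f.1 p.1 - f.1 x₀ * 1) - (f.1 p.2 - f.1 x₀ * 1)| / _ ≤ _
      rw [sub_sub_sub_cancel_right]
    · change f.1 x₀ - f.1 x₀ * 1 = 0
      ring
  obtain ⟨g, hg, hfg⟩ := hF _ hf₀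
  refine ⟨g, hg, f.1 x₀, ?_⟩
  rw [orderBounded_lipOne_iff]
  intro x
  have h2 := (BoundedContinuousFunction.dist_coe_le_dist x).trans hfg.le
  change |(f.1 x - f.1 x₀ * 1) - g.1 x| ≤ ε at h2
  change |f.1 x - g.1 x - f.1 x₀ * 1| ≤ ε
  rwa [sub_right_comm]

theorem isCompactQuantumMetricSpace_lipFun [CompactSpace X] [Nonempty X] :
    IsCompactQuantumMetricSpace (lipOne : LipFun X) lipSeminorm where
  orderUnit := isOrderUnitSpace_lipFun
  lipNorm := .of_hasFiniteNets lipSeminorm_add_le lipSeminorm_smul (lipSeminorm_one (X := X))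
    hasFiniteNets_lipFun

end Lipschitz

/-! ### Bridges between compact quantum metric spaces -/

section Bridge

variable {A : Type*} [AddCommGroup A] [Module ℝ A]
  {X : Type*} [MetricSpace X] [CompactSpace X]

/-- The seminorm `max (L_A(a), L(f), ‖π(a) - f‖ / ε)` on `A ⊕ Lip(X)`. -/
noncomputable def bridgeSeminorm (L : A → ℝ) (π : A →ₗ[ℝ] LipFun X) (ε : ℝ) (p : A × LipFun X) :
    ℝ :=
  max (max (L p.1) (lipSeminorm p.2)) (ε⁻¹ * ‖(π p.1 - p.2).1‖)

theorem bridgeSeminorm_le_one {L : A → ℝ} {π : A →ₗ[ℝ] LipFun X} {ε : ℝ} (hε : 0 < ε)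
    {p : A × LipFun X} (h : bridgeSeminorm L π ε p ≤ 1) :
    L p.1 ≤ 1 ∧ lipSeminorm p.2 ≤ 1 ∧ OrderBounded lipOne ε (π p.1 - p.2) := by
  rw [bridgeSeminorm, max_le_iff, max_le_iff, inv_mul_le_one₀ hε] at h
  exact ⟨h.1.1, h.1.2, orderBounded_lipOne_iff.2 fun x =>
    ((π p.1 - p.2).1.norm_coe_le_norm x).trans h.2⟩

variable [PartialOrder A]

/-- Total boundedness on the direct sum modulo the single constant `(e, 1)`: the constants in the
two summands are tied together by the third term of the seminorm. -/
theorem hasFiniteNets_bridgeSeminorm [Nonempty X] {e : A} {L : A → ℝ} {π : A →ₗ[ℝ] LipFun X} {ε : ℝ}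
    (hε : 0 < ε) (hA : IsOrderUnitSpace e) (nets : HasFiniteNets e L)
    (π_one : π e = lipOne) (π_nonneg : ∀ a, 0 ≤ a → 0 ≤ π a) :
    HasFiniteNets (e, (lipOne : LipFun X)) (bridgeSeminorm L π ε) := by
  classical
  intro δ hδ
  have hB := isOrderUnitSpace_lipFun (X := X)
  obtain ⟨F, hF⟩ := nets (δ / 2) (half_pos hδ)
  obtain ⟨G, hG⟩ := hasFiniteNets_lipFun (X := X) (δ / 2) (half_pos hδ)
  -- The two additive constants differ by a bounded amount, because `π a` and `f` are close.
  obtain ⟨M, hM⟩ : ∃ M : ℝ, ∀ p ∈ F ×ˢ G, ‖(π p.1 - p.2).1‖ + ε + δ ≤ M := by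
    obtain ⟨M, hM⟩ := ((F ×ˢ G).image fun p => ‖(π p.1 - p.2).1‖ + ε + δ).bddAbove
    exact ⟨M, fun p hp => hM (Finset.mem_coe.2 (Finset.mem_image_of_mem _ hp))⟩
  have htb : TotallyBounded (id '' Metric.closedBall (0 : ℝ) M) := by
    rw [Set.image_id]
    exact (isCompact_closedBall _ _).totallyBounded
  obtain ⟨T, -, hT⟩ := exists_finset_dist_image_lt htb (half_pos hδ)
  refine ⟨((F ×ˢ G) ×ˢ T).image fun q => (q.1.1, q.1.2 + q.2 • lipOne), fun p hp => ?_⟩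
  obtain ⟨hp1, hp2, hp3⟩ := bridgeSeminorm_le_one hε hp
  obtain ⟨b, hb, r, hr⟩ := hF _ hp1
  obtain ⟨g, hg, s, hs⟩ := hG _ hp2
  have hsr : s - r ∈ Metric.closedBall (0 : ℝ) M := by
    rw [mem_closedBall_zero_iff, Real.norm_eq_abs]
    refine le_trans ?_ (hM (b, g) (Finset.mk_mem_product hb hg))
    have h1 := ((hr.map π_nonneg π_one).neg.add hB hs).add hB hp3
    obtain ⟨x⟩ := ‹Nonempty X›
    have h2 := orderBounded_lipOne_iff.1 h1 x
    have h3 : |(π b - g).1 x| ≤ ‖(π b - g).1‖ := (π b - g).1.norm_coe_le_norm x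
    have h4 : (π b - g).1 x = (π b).1 x - g.1 x := rfl
    have h5 : (-π (p.1 - b - r • e) + (p.2 - g - s • lipOne) + (π p.1 - p.2)).1 x =
        (π b).1 x - g.1 x + (r - s) := by
      rw [map_sub, map_sub, map_smul, π_one]
      change -((π p.1).1 x - (π b).1 x - r * 1) + (p.2.1 x - g.1 x - s * 1) +
        ((π p.1).1 x - p.2.1 x) = _
      ring
    rw [h5] at h2
    rw [h4] at h3
    change |s - r| ≤ ‖(π b - g).1‖ + ε + δ
    rw [abs_le] at *
    constructor <;> linarith [h2.1, h2.2, h3.1, h3.2]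
  obtain ⟨t, ht, hst⟩ := hT _ hsr
  refine ⟨_, Finset.mem_image_of_mem _ (Finset.mk_mem_product (Finset.mk_mem_product hb hg) ht),
    r, ?_⟩
  have h1 := hr.mono hA (by linarith : δ / 2 ≤ δ)
  have h2 : OrderBounded lipOne δ (p.2 - (g + t • lipOne) - r • lipOne) := by
    have h3 : OrderBounded lipOne (δ / 2) ((s - r - t) • (lipOne : LipFun X)) :=
      .smul_unit hB hst.le
    replace h3 := (hs.add hB h3).mono hB (add_halves δ).le
    convert h3 using 1
    module
  exact ⟨⟨h1.1, h2.1⟩, ⟨h1.2, h2.2⟩⟩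

theorem isLipNorm_bridgeSeminorm [Nonempty X] {e : A} {L : A → ℝ} {π : A →ₗ[ℝ] LipFun X} {ε : ℝ}
    (hε : 0 < ε) (hA : IsOrderUnitSpace e) (hL : IsLipNorm e L) (nets : HasFiniteNets e L)
    (π_one : π e = lipOne) (π_nonneg : ∀ a, 0 ≤ a → 0 ≤ π a) :
    IsLipNorm (e, (lipOne : LipFun X)) (bridgeSeminorm L π ε) := by
  refine .of_hasFiniteNets (fun a b => ?_) (fun r a => ?_) ?_
    (hasFiniteNets_bridgeSeminorm hε hA nets π_one π_nonneg)
  · refine max_le (max_le ((hL.add_le a.1 b.1).trans (add_le_add ?_ ?_))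
      ((lipSeminorm_add_le a.2 b.2).trans (add_le_add ?_ ?_))) ?_
    · exact (le_max_left _ _).trans (le_max_left _ _)
    · exact (le_max_left _ _).trans (le_max_left _ _)
    · exact (le_max_right _ _).trans (le_max_left _ _)
    · exact (le_max_right _ _).trans (le_max_left _ _)
    · refine le_trans ?_ (add_le_add (le_max_right _ _) (le_max_right _ _))
      rw [← mul_add]
      gcongr
      have : (π (a + b).1 - (a + b).2).1 = (π a.1 - a.2).1 + (π b.1 - b.2).1 := by
        rw [Prod.fst_add, Prod.snd_add, map_add, add_sub_add_comm]
        rfl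
      rw [this]
      exact norm_add_le _ _
  · have : (π (r • a).1 - (r • a).2).1 = r • (π a.1 - a.2).1 := by
      rw [Prod.smul_fst, Prod.smul_snd, map_smul]
      exact congrArg Subtype.val (smul_sub r (π a.1) a.2).symm
    rw [bridgeSeminorm, bridgeSeminorm, Prod.smul_fst, Prod.smul_snd, hL.smul_eq, lipSeminorm_smul,
      ← Prod.smul_fst, ← Prod.smul_snd, this, norm_smul, mul_max_of_nonneg _ _ (abs_nonneg r),
      mul_max_of_nonneg _ _ (abs_nonneg r), Real.norm_eq_abs, mul_left_comm]
  · simp [bridgeSeminorm, π_one, hL.map_unit, lipSeminorm_one]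

/-- A unital positive projection `π : A → Lip(X)` with unital positive section `τ`, both of them
contractive for the Lip-norms, bounds the quantum Gromov–Hausdorff distance by the size of
`a - τ (π a)` on the unit ball of `L`. -/
theorem quantumGHDist_le_of_section [Nonempty X] {e : A} {L : A → ℝ} {π : A →ₗ[ℝ] LipFun X}
    {τ : LipFun X →ₗ[ℝ] A} {ε : ℝ} (hε : 0 < ε) (hA : IsOrderUnitSpace e) (hL : IsLipNorm e L)
    (nets : HasFiniteNets e L) (π_one : π e = lipOne) (π_nonneg : ∀ a, 0 ≤ a → 0 ≤ π a)
    (τ_one : τ lipOne = e) (τ_nonneg : ∀ f, 0 ≤ f → 0 ≤ τ f) (π_τ : ∀ f, π (τ f) = f)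
    (L_τ : ∀ f, L (τ f) ≤ lipSeminorm f) (lip_π : ∀ a, lipSeminorm (π a) ≤ L a)
    (close : ∀ a, L a ≤ 1 → OrderBounded e ε (a - τ (π a))) :
    quantumGHDist e L (lipOne : LipFun X) lipSeminorm ≤ ENNReal.ofReal (2 * ε) := by
  have hmem : bridgeSeminorm L π ε ∈ inducingLipNorms e L (lipOne : LipFun X) lipSeminorm := by
    refine ⟨isLipNorm_bridgeSeminorm hε hA hL nets π_one π_nonneg, fun a => ⟨?_, fun c hc => ?_⟩,
      fun f => ⟨?_, fun c hc => ?_⟩⟩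
    · rintro _ ⟨f, rfl⟩
      exact (le_max_left _ _).trans (le_max_left _ _)
    · refine (hc ⟨π a, rfl⟩).trans (max_le (max_le le_rfl (lip_π a)) ?_)
      simpa using (lipSeminorm_nonneg _).trans (lip_π a)
    · rintro _ ⟨a, rfl⟩
      exact (le_max_right _ _).trans (le_max_left _ _)
    · refine (hc ⟨τ f, rfl⟩).trans (max_le (max_le (L_τ f) le_rfl) ?_)
      simpa [π_τ] using lipSeminorm_nonneg f
  refine (iInf₂_le _ hmem).trans ?_
  let := stateMetric (e, (lipOne : LipFun X)) (bridgeSeminorm L π ε)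
  refine Metric.hausdorffEDist_le_of_mem_edist ?_ ?_
  · rintro _ ⟨μ, rfl⟩
    let ν : StateSpace (lipOne : LipFun X) :=
      ⟨μ.1 ∘ₗ τ, fun f hf => μ.2.1 _ (τ_nonneg f hf), by simp [τ_one, μ.2.2]⟩
    refine ⟨_, ⟨ν, rfl⟩, iSup₂_le fun p hp => ?_⟩
    obtain ⟨hp1, -, hp3⟩ := bridgeSeminorm_le_one hε hp
    have h1 := ((close _ hp1).add hA (hp3.map τ_nonneg τ_one)).abs_state_le μ
    change edist (μ.1 p.1) (μ.1 (τ p.2)) ≤ _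
    rw [edist_dist, Real.dist_eq, ← map_sub]
    refine ENNReal.ofReal_le_ofReal ?_
    rwa [map_sub τ, sub_add_sub_cancel, ← two_mul] at h1
  · rintro _ ⟨ν, rfl⟩
    let μ : StateSpace e :=
      ⟨ν.1 ∘ₗ π, fun a ha => ν.2.1 _ (π_nonneg a ha), by simp [π_one, ν.2.2]⟩
    refine ⟨_, ⟨μ, rfl⟩, iSup₂_le fun p hp => ?_⟩
    obtain ⟨-, -, hp3⟩ := bridgeSeminorm_le_one hε hp
    have h1 := hp3.abs_state_le ν
    change edist (ν.1 p.2) (ν.1 (π p.1)) ≤ _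
    rw [edist_comm, edist_dist, Real.dist_eq, ← map_sub]
    exact ENNReal.ofReal_le_ofReal (h1.trans (by linarith))

end Bridge

/-! ### Weighted matrix entries and the operator norm -/

section HilbertSchmidt

variable {H : Type*} [NormedAddCommGroup H] [InnerProductSpace ℂ H]

theorem hasSum_sq_norm_inner {ι : Type*} (b : HilbertBasis ι ℂ H) (x : H) :
    HasSum (fun i => ‖⟪b i, x⟫_ℂ‖ ^ 2) (‖x‖ ^ 2) := by
  have h := Complex.hasSum_re (b.hasSum_inner_mul_inner x x)
  have h1 : (⟪x, x⟫_ℂ).re = ‖x‖ ^ 2 := (norm_sq_eq_re_inner (𝕜 := ℂ) x).symm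
  rw [h1] at h
  convert h using 2 with i
  rw [← inner_conj_symm x (b i), ← Complex.normSq_eq_conj_mul_self, Complex.ofReal_re,
    Complex.normSq_eq_norm_sq]

/-- The operator norm is at most the Hilbert–Schmidt norm. -/
theorem norm_sq_le_tsum_of_entries [CompleteSpace H] {ι : Type*} (b : HilbertBasis ι ℂ H) (D : H →L[ℂ] H)
    {c : ι × ι → ℝ} (hc : Summable c) (h : ∀ i j, ‖⟪b j, D (b i)⟫_ℂ‖ ^ 2 ≤ c (i, j)) :
    ‖D‖ ^ 2 ≤ ∑' p, c p := by
  have hc' : Summable fun p : ι × ι => c (p.2, p.1) := hc.prod_symm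
  have hsum : ∑' p, c p = ∑' j, ∑' i, c (i, j) := by
    rw [← hc'.tsum_prod]
    exact ((Equiv.prodComm ι ι).tsum_eq c).symm
  have hcol : ∀ j, ‖D.adjoint (b j)‖ ^ 2 ≤ ∑' i, c (i, j) := fun j => by
    have h1 := hasSum_sq_norm_inner b (D.adjoint (b j))
    rw [← h1.tsum_eq]
    refine h1.summable.tsum_le_tsum (fun i => ?_) (hc'.prod_factor j)
    rw [ContinuousLinearMap.adjoint_inner_right, norm_inner_symm]
    exact h i j
  have hS : 0 ≤ ∑' p, c p := tsum_nonneg fun p => (sq_nonneg _).trans (h p.1 p.2)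
  have hD : ‖D‖ ≤ Real.sqrt (∑' p, c p) := by
    refine D.opNorm_le_bound (Real.sqrt_nonneg _) fun x => ?_
    rw [← Real.sqrt_sq (norm_nonneg x), ← Real.sqrt_mul hS]
    refine Real.le_sqrt_of_sq_le ?_
    have h1 := hasSum_sq_norm_inner b (D x)
    rw [← h1.tsum_eq, hsum, ← tsum_mul_right]
    refine h1.summable.tsum_le_tsum (fun j => ?_) (hc'.prod.mul_right _)
    rw [← ContinuousLinearMap.adjoint_inner_left]
    calc ‖⟪D.adjoint (b j), x⟫_ℂ‖ ^ 2 ≤ (‖D.adjoint (b j)‖ * ‖x‖) ^ 2 := by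
          gcongr; exact norm_inner_le_norm _ _
      _ = ‖D.adjoint (b j)‖ ^ 2 * ‖x‖ ^ 2 := mul_pow _ _ _
      _ ≤ _ := by gcongr; exact hcol j
  calc ‖D‖ ^ 2 ≤ Real.sqrt (∑' p, c p) ^ 2 := by gcongr
    _ = _ := Real.sq_sqrt hS

/-- The square-summable weight `1 / (i j)` on pairs of positive integers. -/
noncomputable def entryWeight (p : ℕ × ℕ) : ℝ := 1 / ((p.1 : ℝ) + 1) * (1 / ((p.2 : ℝ) + 1))

theorem entryWeight_pos (p : ℕ × ℕ) : 0 < entryWeight p := by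
  unfold entryWeight
  positivity

theorem entryWeight_le_one (p : ℕ × ℕ) : entryWeight p ≤ 1 := by
  have h (i : ℕ) : 1 / ((i : ℝ) + 1) ≤ 1 := (div_le_one (by positivity)).2 (by simp)
  exact mul_le_one₀ (h _) (by positivity) (h _)

theorem summable_entryWeight_sq : Summable fun p => entryWeight p ^ 2 := by
  have h : Summable fun i : ℕ => (1 / ((i : ℝ) + 1)) ^ 2 := by
    have := (summable_nat_add_iff 1).2 (Real.summable_one_div_nat_pow.2 one_lt_two)
    simpa [div_pow] using this
  simpa only [entryWeight, mul_pow] using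
    h.mul_of_nonneg h (fun _ => by positivity) fun _ => by positivity

theorem compactSeminorm_nonneg (N : ℕ) (e : HilbertBasis ℕ ℂ H) (K : H →L[ℂ] H) :
    0 ≤ compactSeminorm N e K :=
  Real.iSup_nonneg fun _ => by unfold weightedEntry; positivity

theorem compactSeminorm_smul (N : ℕ) (e : HilbertBasis ℕ ℂ H) (r : ℝ) (K : H →L[ℂ] H) :
    compactSeminorm N e (r • K) = |r| * compactSeminorm N e K := by
  rw [compactSeminorm, compactSeminorm, Real.mul_iSup_of_nonneg (abs_nonneg r)]
  congr 1
  ext p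
  have : ⟪e p.2, (r • K) (e p.1)⟫_ℂ = r * ⟪e p.2, K (e p.1)⟫_ℂ := by
    have : (r • K) (e p.1) = (r : ℂ) • K (e p.1) := rfl
    rw [this, inner_smul_right]
  simp only [weightedEntry, this, norm_mul, Complex.norm_real, Real.norm_eq_abs]
  ring

variable [CompleteSpace H] {n : ℕ} {e : HilbertBasis ℕ ℂ H} {K : H →L[ℂ] H}

theorem compactSeminorm_add_le {N : ℕ} {K' : H →L[ℂ] H} (hK : K ∈ lipCompact N e)
    (hK' : K' ∈ lipCompact N e) :
    compactSeminorm N e (K + K') ≤ compactSeminorm N e K + compactSeminorm N e K' := by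
  refine Real.iSup_le (fun p => ?_)
    (add_nonneg (compactSeminorm_nonneg N e K) (compactSeminorm_nonneg N e K'))
  refine le_trans ?_ (add_le_add (le_ciSup hK.2.2.2 p) (le_ciSup hK'.2.2.2 p))
  simp only [weightedEntry, ← mul_add, add_apply, inner_add_right]
  gcongr
  exact norm_add_le _ _

theorem norm_entry_le (hK : K ∈ lipCompact (n + 2) e) (p : ℕ × ℕ) :
    ‖⟪e p.2, K (e p.1)⟫_ℂ‖ ≤ compactSeminorm (n + 2) e K * (1 / 2) ^ n * entryWeight p := by
  have h1 : weightedEntry (n + 2) e K p ≤ compactSeminorm (n + 2) e K := le_ciSup hK.2.2.2 p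
  set a : ℝ := (p.1 : ℝ) + 1
  set b : ℝ := (p.2 : ℝ) + 1
  have ha : 1 ≤ a := by simp [a]
  have hb : 1 ≤ b := by simp [b]
  have h2 : (2 : ℝ) ^ n * (a * b) ≤ (((p.1 + 1) + (p.2 + 1) : ℕ) : ℝ) ^ (n + 2) := by
    rw [pow_add]
    push_cast
    change _ ≤ (a + b) ^ n * (a + b) ^ 2
    gcongr
    · linarith
    · nlinarith
  have h3 : compactSeminorm (n + 2) e K * (1 / 2) ^ n * entryWeight p =
      compactSeminorm (n + 2) e K / (2 ^ n * (a * b)) := by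
    rw [entryWeight, one_div_pow]
    change _ * (1 / a * (1 / b)) = _
    field_simp
  rw [h3, le_div_iff₀ (by positivity), mul_comm]
  exact (mul_le_mul_of_nonneg_right h2 (norm_nonneg _)).trans h1

/-- The operator norm is bounded by the weighted seminorm, with a constant decaying
exponentially in the exponent of the weight. -/
theorem norm_le_compactSeminorm (hK : K ∈ lipCompact (n + 2) e) :
    ‖K‖ ≤ compactSeminorm (n + 2) e K * (1 / 2) ^ n * Real.sqrt (∑' p, entryWeight p ^ 2) := by
  set a := compactSeminorm (n + 2) e K * (1 / 2) ^ n
  have ha : 0 ≤ a := mul_nonneg (compactSeminorm_nonneg _ _ _) (by positivity)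
  have h := norm_sq_le_tsum_of_entries e K (summable_entryWeight_sq.mul_left (a ^ 2))
    fun i j => by
      rw [← mul_pow]
      gcongr
      exact norm_entry_le hK (i, j)
  rw [tsum_mul_left] at h
  calc ‖K‖ = Real.sqrt (‖K‖ ^ 2) := (Real.sqrt_sq (norm_nonneg _)).symm
    _ ≤ Real.sqrt (a ^ 2 * ∑' p, entryWeight p ^ 2) := Real.sqrt_le_sqrt h
    _ = _ := by rw [Real.sqrt_mul (sq_nonneg a), Real.sqrt_sq ha]

/-- The unit ball of the weighted seminorm is totally bounded in operator norm: up to a small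
Hilbert–Schmidt error, an operator in it is determined by finitely many bounded entries. -/
theorem exists_finset_lipCompact (n : ℕ) (e : HilbertBasis ℕ ℂ H) {ε : ℝ} (hε : 0 < ε) :
    ∃ F : Finset (H →L[ℂ] H), (∀ K ∈ F, K ∈ lipCompact (n + 2) e) ∧
      ∀ K ∈ lipCompact (n + 2) e, compactSeminorm (n + 2) e K ≤ 1 → ∃ K' ∈ F, ‖K - K'‖ ≤ ε := by
  let S : Set (H →L[ℂ] H) := {K | K ∈ lipCompact (n + 2) e ∧ compactSeminorm (n + 2) e K ≤ 1}
  have hS : ∀ K ∈ S, ∀ p : ℕ × ℕ, ‖⟪e p.2, K (e p.1)⟫_ℂ‖ ≤ entryWeight p := fun K hK p => by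
    refine (norm_entry_le hK.1 p).trans (mul_le_of_le_one_left (entryWeight_pos p).le ?_)
    exact mul_le_one₀ hK.2 (by positivity) (pow_le_one₀ (by norm_num) (by norm_num))
  have hw := summable_entryWeight_sq.mul_left 4
  obtain ⟨s, hs⟩ : ∃ s : Finset (ℕ × ℕ), ∑' p, 4 * entryWeight p ^ 2 - ε ^ 2 / 2 <
      ∑ p ∈ s, 4 * entryWeight p ^ 2 :=
    (hw.hasSum.eventually (lt_mem_nhds (by linarith [pow_pos hε 2]))).exists
  -- Errors `η` in the entries over `s` contribute at most `ε² / 2`.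
  set η : ℝ := Real.sqrt (ε ^ 2 / (2 * (s.card + 1)))
  have hη : 0 < η := Real.sqrt_pos.2 (by positivity)
  have hη2 : s.card * η ^ 2 ≤ ε ^ 2 / 2 := by
    rw [Real.sq_sqrt (by positivity)]
    have : (s.card : ℝ) * (ε ^ 2 / (2 * (s.card + 1))) =
        ε ^ 2 / 2 * (s.card / (s.card + 1)) := by field_simp
    rw [this]
    refine mul_le_of_le_one_right (by positivity) ((div_le_one (by positivity)).2 (by linarith))
  let J : (H →L[ℂ] H) → (s → ℂ) := fun K p => ⟪e p.1.2, K (e p.1.1)⟫_ℂ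
  have htb : TotallyBounded (J '' S) := by
    refine (isCompact_closedBall (0 : s → ℂ) 1).totallyBounded.subset ?_
    rintro _ ⟨K, hK, rfl⟩
    rw [mem_closedBall_zero_iff, pi_norm_le_iff_of_nonneg zero_le_one]
    exact fun p => (hS K hK p).trans (entryWeight_le_one p)
  obtain ⟨F, hFS, hF⟩ := exists_finset_dist_image_lt htb hη
  refine ⟨F, fun K hK => (hFS K hK).1, fun K hK hK1 => ?_⟩
  obtain ⟨K', hK', hd⟩ := hF K ⟨hK, hK1⟩
  refine ⟨K', hK', ?_⟩
  classical
  -- The entries of `K - K'` are at most `η` on `s`, and at most twice the weight elsewhere.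
  set g : ℕ × ℕ → ℝ := fun p => if p ∈ s then η ^ 2 - 4 * entryWeight p ^ 2 else 0
  have hg : HasSum g (∑ p ∈ s, (η ^ 2 - 4 * entryWeight p ^ 2)) := by
    have : HasSum g (∑ p ∈ s, g p) := hasSum_sum_of_ne_finset_zero fun p hp => if_neg hp
    rwa [Finset.sum_congr rfl fun p hp => if_pos hp] at this
  have hsum := hw.hasSum.add hg
  have h := norm_sq_le_tsum_of_entries e (K - K') hsum.summable fun i j => by
    simp only [g]
    split_ifs with hp
    · rw [add_sub_cancel]
      have h1 := (dist_le_pi_dist (J K) (J K') ⟨(i, j), hp⟩).trans hd.le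
      rw [dist_eq_norm] at h1
      rw [sub_apply, inner_sub_right]
      gcongr
    · have h1 := (norm_sub_le _ _).trans
        (add_le_add (hS K ⟨hK, hK1⟩ (i, j)) (hS K' (hFS K' hK') (i, j)))
      rw [sub_apply, inner_sub_right, add_zero]
      calc _ ≤ (entryWeight (i, j) + entryWeight (i, j)) ^ 2 := by gcongr
        _ = _ := by ring
  rw [hsum.tsum_eq, Finset.sum_sub_distrib, Finset.sum_const, nsmul_eq_mul] at h
  exact le_of_sq_le_sq (by linarith) hε.le

end HilbertSchmidt

/-! ### Weakly null sequences -/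

section WeaklyNull

/-- A compact operator has asymptotically vanishing expectation along a bounded weakly null
sequence. -/
theorem tendsto_inner_of_isCompactOperator {H : Type*} [NormedAddCommGroup H]
    [InnerProductSpace ℂ H] {K : H →L[ℂ] H} (hK : IsCompactOperator K) {x : ℕ → H}
    (hx : ∀ k, ‖x k‖ ≤ 1) (hw : ∀ y, Tendsto (fun k => ⟪y, x k⟫_ℂ) atTop (𝓝 0)) :
    Tendsto (fun k => ⟪K (x k), x k⟫_ℂ) atTop (𝓝 0) := by
  rw [Metric.tendsto_nhds]
  intro ε hε
  obtain ⟨S, hS, hKS⟩ := hK.image_closedBall_subset_compact (f := (K : H →ₗ[ℂ] H)) 1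
  obtain ⟨t, -, htf, ht⟩ :=
    Metric.finite_approx_of_totallyBounded hS.totallyBounded (ε / 2) (half_pos hε)
  have hev : ∀ᶠ k in atTop, ∀ y ∈ t, ‖⟪y, x k⟫_ℂ‖ < ε / 2 := by
    rw [eventually_all_finite htf]
    intro y _
    have := (hw y).norm
    rw [norm_zero] at this
    exact this.eventually (gt_mem_nhds (half_pos hε))
  filter_upwards [hev] with k hk
  have hmem : K (x k) ∈ S := hKS ⟨x k, by simpa using hx k, rfl⟩
  obtain ⟨y, hy, hxy⟩ := Set.mem_iUnion₂.1 (ht hmem)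
  rw [mem_ball_iff_norm] at hxy
  rw [dist_zero_right]
  calc ‖⟪K (x k), x k⟫_ℂ‖ = ‖⟪K (x k) - y, x k⟫_ℂ + ⟪y, x k⟫_ℂ‖ := by
        rw [← inner_add_left, sub_add_cancel]
    _ ≤ ‖K (x k) - y‖ * ‖x k‖ + ‖⟪y, x k⟫_ℂ‖ :=
        (norm_add_le _ _).trans (add_le_add_left (norm_inner_le_norm _ _) _)
    _ < ε / 2 + ε / 2 := by
        refine add_lt_add ?_ (hk y hy)
        exact (mul_le_of_le_one_right (norm_nonneg _) (hx k)).trans_lt hxy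
    _ = ε := add_halves ε

variable {Ω : Type*} [MeasurableSpace Ω] {μ : Measure Ω}

theorem integrable_sq_norm_Lp (f : Lp ℂ 2 μ) : Integrable (fun z => ‖f z‖ ^ 2) μ :=
  (memLp_two_iff_integrable_sq_norm (Lp.aestronglyMeasurable f)).1 (Lp.memLp f)

theorem integral_sq_norm_Lp (f : Lp ℂ 2 μ) : ∫ z, ‖f z‖ ^ 2 ∂μ = ‖f‖ ^ 2 := by
  have h : ((∫ z, ‖f z‖ ^ 2 ∂μ : ℝ) : ℂ) = ((‖f‖ ^ 2 : ℝ) : ℂ) := by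
    rw [← integral_complex_ofReal]
    have := inner_self_eq_norm_sq_to_K (𝕜 := ℂ) f
    rw [L2.inner_def] at this
    simpa [inner_self_eq_norm_sq_to_K] using this
  exact_mod_cast h

/-- If the mass of `|x_k|²` concentrates on sets shrinking to a null set, then `x_k` tends to `0`
weakly in `L²`. -/
theorem tendsto_inner_of_concentrating {x : ℕ → Lp ℂ 2 μ} (hx : ∀ k, ‖x k‖ ≤ 1) {U : ℕ → Set Ω}
    (hU : ∀ m, MeasurableSet (U m)) (hanti : Antitone U) (hnull : μ (⋂ m, U m) = 0)
    (hconc : ∀ m, Tendsto (fun k => ∫ z in (U m)ᶜ, ‖x k z‖ ^ 2 ∂μ) atTop (𝓝 0)) (y : Lp ℂ 2 μ) :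
    Tendsto (fun k => ⟪y, x k⟫_ℂ) atTop (𝓝 0) := by
  rw [Metric.tendsto_nhds]
  intro ε hε
  obtain ⟨t, ht, ht1⟩ : ∃ t : ℝ, 0 < t ∧ t * (1 + ‖y‖ ^ 2) ≤ ε / 2 :=
    ⟨ε / 2 / (1 + ‖y‖ ^ 2), by positivity, (div_mul_cancel₀ _ (by positivity)).le⟩
  have hA : Tendsto (fun m => ∫ z in U m, ‖y z‖ ^ 2 ∂μ) atTop (𝓝 0) := by
    have := tendsto_setIntegral_of_antitone hU hanti
      ⟨0, (integrable_sq_norm_Lp y).integrableOn⟩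
    rwa [setIntegral_measure_zero _ hnull] at this
  have htε : 0 < t * (ε / 2) := by positivity
  obtain ⟨m, hm⟩ := (hA.eventually (gt_mem_nhds htε)).exists
  filter_upwards [(hconc m).eventually (gt_mem_nhds htε)] with k hk
  rw [dist_zero_right, L2.inner_def]
  set g : Ω → ℝ := fun z => t⁻¹ / 2 * (U m).indicator (fun z => ‖y z‖ ^ 2) z +
    t / 2 * (‖x k z‖ ^ 2 + ‖y z‖ ^ 2) + t⁻¹ / 2 * (U m)ᶜ.indicator (fun z => ‖x k z‖ ^ 2) z
  have hi1 := ((integrable_sq_norm_Lp y).indicator (hU m)).const_mul (t⁻¹ / 2)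
  have hi2 : Integrable (fun z => t / 2 * (‖x k z‖ ^ 2 + ‖y z‖ ^ 2)) μ :=
    ((integrable_sq_norm_Lp (x k)).add (integrable_sq_norm_Lp y)).const_mul (t / 2)
  have hi3 := ((integrable_sq_norm_Lp (x k)).indicator (hU m).compl).const_mul (t⁻¹ / 2)
  -- `2ab ≤ s a² + b² / s` for `a = ‖y z‖` and `b = ‖x k z‖`, with `s = 1 / t` on `U m` and `s = t` off it.
  have hpt : ∀ z, ‖⟪y z, x k z⟫_ℂ‖ ≤ g z := fun z => by
    refine (norm_inner_le_norm _ _).trans ?_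
    have key : ∀ a b : ℝ, a * b ≤ t⁻¹ / 2 * a ^ 2 + t / 2 * b ^ 2 := fun a b => by
      have h1 : t⁻¹ / 2 * a ^ 2 + t / 2 * b ^ 2 - a * b = t⁻¹ / 2 * (a - t * b) ^ 2 := by
        field_simp
        ring
      have h2 : 0 ≤ t⁻¹ / 2 * (a - t * b) ^ 2 := by positivity
      linarith
    by_cases hz : z ∈ U m
    · have h1 := key ‖y z‖ ‖x k z‖
      have h2 : 0 ≤ t / 2 * ‖y z‖ ^ 2 := by positivity
      simp only [g, Set.indicator_of_mem hz, Set.indicator_of_notMem (Set.notMem_compl_iff.2 hz)]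
      linarith
    · have h1 := key ‖x k z‖ ‖y z‖
      have h2 : 0 ≤ t / 2 * ‖x k z‖ ^ 2 := by positivity
      simp only [g, Set.indicator_of_notMem hz, Set.indicator_of_mem (Set.mem_compl hz)]
      linarith
  refine (norm_integral_le_of_norm_le ((hi1.add hi2).add hi3) (Eventually.of_forall hpt)).trans_lt ?_
  have hg : ∫ z, g z ∂μ = t⁻¹ / 2 * (∫ z in U m, ‖y z‖ ^ 2 ∂μ) + t / 2 * (‖x k‖ ^ 2 + ‖y‖ ^ 2) +
      t⁻¹ / 2 * ∫ z in (U m)ᶜ, ‖x k z‖ ^ 2 ∂μ := by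
    rw [← integral_indicator (hU m), ← integral_indicator (hU m).compl, ← integral_sq_norm_Lp (x k),
      ← integral_sq_norm_Lp y, ← integral_add (integrable_sq_norm_Lp _) (integrable_sq_norm_Lp _),
      ← integral_const_mul, ← integral_const_mul, ← integral_const_mul,
      ← integral_add hi1 hi2]
    exact integral_add (hi1.add hi2) hi3
  change ∫ z, g z ∂μ < ε
  rw [hg]
  have h1 : t⁻¹ / 2 * (∫ z in U m, ‖y z‖ ^ 2 ∂μ) ≤ t⁻¹ / 2 * (t * (ε / 2)) := by gcongr
  have h2 : t⁻¹ / 2 * (∫ z in (U m)ᶜ, ‖x k z‖ ^ 2 ∂μ) ≤ t⁻¹ / 2 * (t * (ε / 2)) := by gcongr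
  have h3 : t⁻¹ / 2 * (t * (ε / 2)) = ε / 4 := by field_simp; ring
  have h4 : t / 2 * (‖x k‖ ^ 2 + ‖y‖ ^ 2) ≤ t / 2 * (1 + ‖y‖ ^ 2) := by
    gcongr
    exact pow_le_one₀ (norm_nonneg _) (hx k)
  linarith

end WeaklyNull

/-! ### Peak functions in the Bergman space -/

section Peak

variable {d : ℕ}

theorem continuous_density (d n : ℕ) : Continuous (density d n) := by
  unfold density
  fun_prop

theorem ae_mem_ball (d n : ℕ) : ∀ᵐ z ∂ballMeasure d n, z ∈ Metric.ball (0 : Cd d) 1 :=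
  (withDensity_absolutelyContinuous _ _).ae_le (ae_restrict_mem Metric.isOpen_ball.measurableSet)

instance isFiniteMeasure_ballMeasure (d n : ℕ) : IsFiniteMeasure (ballMeasure d n) := by
  refine isFiniteMeasure_withDensity_ofReal ?_
  exact (((continuous_density d n).continuousOn.integrableOn_compact
    (isCompact_closedBall (0 : Cd d) 1)).mono_set Metric.ball_subset_closedBall).2

theorem ballMeasure_pos_of_mem_sphere (n : ℕ) {ζ : Cd d} (hζ : ζ ∈ Metric.sphere (0 : Cd d) 1)
    {u : Set (Cd d)} (hu : IsOpen u) (hζu : ζ ∈ u) :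
    0 < ballMeasure d n (u ∩ Metric.closedBall 0 1) := by
  have hne : (u ∩ Metric.ball (0 : Cd d) 1).Nonempty := by
    have : ζ ∈ closure (Metric.ball (0 : Cd d) 1) := by
      rw [closure_ball _ one_ne_zero]
      exact Metric.sphere_subset_closedBall hζ
    exact mem_closure_iff.1 this u hu hζu
  have hpos := (hu.inter Metric.isOpen_ball).measure_pos (lebesgue d) hne
  refine lt_of_lt_of_le ?_ (measure_mono (Set.inter_subset_inter_right u
    Metric.ball_subset_closedBall))
  have hm : MeasurableSet (u ∩ Metric.ball (0 : Cd d) 1) :=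
    (hu.inter Metric.isOpen_ball).measurableSet
  rw [ballMeasure, withDensity_apply _ hm, Measure.restrict_restrict hm, Set.inter_assoc,
    Set.inter_self, setLIntegral_pos_iff (by have := continuous_density d n; fun_prop)]
  refine hpos.trans_le (measure_mono fun z hz => ⟨?_, hz⟩)
  have hz1 : ‖z‖ < 1 := mem_ball_zero_iff.1 hz.2
  have : 0 < 1 - ‖z‖ ^ 2 := by nlinarith [norm_nonneg z]
  rw [Function.mem_support, ne_eq, ENNReal.ofReal_eq_zero, not_le, density]
  positivity

/-- The holomorphic function `(1 + ⟨z, ζ⟩) / 2`, whose modulus on the closed unit ball has its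
maximum `1` only at the point `ζ` of the sphere. -/
noncomputable def peakFun (ζ z : Cd d) : ℂ := (1 + ⟪ζ, z⟫_ℂ) / 2

theorem differentiable_peakFun (ζ : Cd d) : Differentiable ℂ (peakFun ζ) := by
  have : Differentiable ℂ fun z : Cd d => ⟪ζ, z⟫_ℂ := (innerSL ℂ ζ).differentiable
  unfold peakFun
  fun_prop

theorem norm_peakFun_sq_le {ζ z : Cd d} (hζ : ‖ζ‖ = 1) (hz : ‖z‖ ≤ 1) :
    ‖peakFun ζ z‖ ^ 2 ≤ 1 - ‖z - ζ‖ ^ 2 / 4 := by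
  have h1 : ‖⟪ζ, z⟫_ℂ‖ ≤ 1 := (norm_inner_le_norm _ _).trans (by rw [hζ, one_mul]; exact hz)
  have h2 := norm_sub_sq (𝕜 := ℂ) z ζ
  rw [hζ, inner_re_symm] at h2
  have h3 := norm_add_sq (𝕜 := ℂ) (1 : ℂ) ⟪ζ, z⟫_ℂ
  have h4 : ⟪(1 : ℂ), ⟪ζ, z⟫_ℂ⟫_ℂ = ⟪ζ, z⟫_ℂ := by simp
  rw [h4, norm_one] at h3
  have h5 : ‖peakFun ζ z‖ ^ 2 = ‖1 + ⟪ζ, z⟫_ℂ‖ ^ 2 / 4 := by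
    rw [peakFun, norm_div, div_pow]
    norm_num
  rw [h5, h3]
  nlinarith [norm_nonneg z, norm_nonneg ⟪ζ, z⟫_ℂ]

theorem peakFun_self {ζ : Cd d} (hζ : ‖ζ‖ = 1) : peakFun ζ ζ = 1 := by
  rw [peakFun, inner_self_eq_norm_sq_to_K, hζ]
  norm_num

theorem norm_peakFun_le_one {ζ z : Cd d} (hζ : ‖ζ‖ = 1) (hz : ‖z‖ ≤ 1) : ‖peakFun ζ z‖ ≤ 1 := by
  have := norm_peakFun_sq_le hζ hz
  nlinarith [norm_nonneg (peakFun ζ z), sq_nonneg ‖z - ζ‖]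

theorem memLp_peakFun_pow (n : ℕ) {ζ : Cd d} (hζ : ‖ζ‖ = 1) (k : ℕ) :
    MemLp (fun z => peakFun ζ z ^ k) 2 (ballMeasure d n) := by
  refine MemLp.of_bound ?_ 1 ?_
  · exact ((differentiable_peakFun ζ).continuous.pow k).aestronglyMeasurable
  · filter_upwards [ae_mem_ball d n] with z hz
    rw [norm_pow]
    exact pow_le_one₀ (norm_nonneg _) (norm_peakFun_le_one hζ (mem_ball_zero_iff.1 hz).le)

/-- The `k`-th power of the peak function as an element of the Bergman space. -/
noncomputable def peakPow (n : ℕ) {ζ : Cd d} (hζ : ‖ζ‖ = 1) (k : ℕ) : Bergman d n :=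
  (⟨(memLp_peakFun_pow n hζ k).toLp, fun z => peakFun ζ z ^ k,
    ((differentiable_peakFun ζ).pow k).differentiableOn, MemLp.coeFn_toLp _⟩ : bergman d n)

/-- The normalized power of the peak function. -/
noncomputable def peakVec (n : ℕ) {ζ : Cd d} (hζ : ‖ζ‖ = 1) (k : ℕ) : Bergman d n :=
  ((‖peakPow n hζ k‖⁻¹ : ℝ) : ℂ) • peakPow n hζ k

theorem norm_peakVec_le_one (n : ℕ) {ζ : Cd d} (hζ : ‖ζ‖ = 1) (k : ℕ) : ‖peakVec n hζ k‖ ≤ 1 := by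
  rw [peakVec, norm_smul, Complex.norm_real, norm_inv, norm_norm]
  exact inv_mul_le_one

theorem norm_peakPow_sq (n : ℕ) {ζ : Cd d} (hζ : ‖ζ‖ = 1) (k : ℕ) :
    ‖peakPow n hζ k‖ ^ 2 = ∫ z, (‖peakFun ζ z‖ ^ 2) ^ k ∂ballMeasure d n := by
  refine (integral_sq_norm_Lp (incl d n (peakPow n hζ k))).symm.trans (integral_congr_ae ?_)
  filter_upwards [(memLp_peakFun_pow n hζ k).coeFn_toLp] with z hz
  change ‖(memLp_peakFun_pow n hζ k).toLp _ z‖ ^ 2 = _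
  rw [hz, norm_pow, pow_right_comm]

theorem norm_peakVec_sq_ae (n : ℕ) {ζ : Cd d} (hζ : ‖ζ‖ = 1) (k : ℕ) :
    ∀ᵐ z ∂ballMeasure d n, ‖incl d n (peakVec n hζ k) z‖ ^ 2 =
      (∫ z, (‖peakFun ζ z‖ ^ 2) ^ k ∂ballMeasure d n)⁻¹ * (‖peakFun ζ z‖ ^ 2) ^ k := by
  rw [← norm_peakPow_sq n hζ k, peakVec, map_smul]
  filter_upwards [(memLp_peakFun_pow n hζ k).coeFn_toLp,
    Lp.coeFn_smul (((‖peakPow n hζ k‖⁻¹ : ℝ) : ℂ)) (incl d n (peakPow n hζ k))] with z hz hz'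
  rw [hz']
  change ‖((‖peakPow n hζ k‖⁻¹ : ℝ) : ℂ) • (memLp_peakFun_pow n hζ k).toLp _ z‖ ^ 2 = _
  rw [hz, norm_smul, norm_pow, Complex.norm_real, norm_inv, norm_norm, mul_pow, inv_pow,
    pow_right_comm]

/-- The probability densities `|x_k|²` of the normalized powers `x_k` of the peak function
concentrate at the peak point. -/
theorem tendsto_integral_peakVec {E : Type*} [NormedAddCommGroup E] [NormedSpace ℝ E]
    [CompleteSpace E] (n : ℕ) {ζ : Cd d} (hζ : ‖ζ‖ = 1) {g : Cd d → E}
    (hg : Integrable g (ballMeasure d n))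
    (hgc : ContinuousWithinAt g (Metric.closedBall 0 1) ζ) :
    Tendsto (fun k => ∫ z, ‖incl d n (peakVec n hζ k) z‖ ^ 2 • g z ∂ballMeasure d n) atTop
      (𝓝 (g ζ)) := by
  have hrestr : (ballMeasure d n).restrict (Metric.closedBall 0 1) = ballMeasure d n :=
    Measure.restrict_eq_self_of_ae_mem
      ((ae_mem_ball d n).mono fun z hz => Metric.ball_subset_closedBall hz)
  have h := tendsto_setIntegral_pow_smul_of_unique_maximum_of_isCompact_of_measure_nhdsWithin_pos
    (μ := ballMeasure d n) (isCompact_closedBall (0 : Cd d) 1) (x₀ := ζ)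
    (fun u hu hζu => ballMeasure_pos_of_mem_sphere n (by simpa using hζ) hu hζu)
    (c := fun z => ‖peakFun ζ z‖ ^ 2)
    ((differentiable_peakFun ζ).continuous.norm.pow 2).continuousOn
    (fun z hz hne => by
      have h1 := norm_peakFun_sq_le hζ (mem_closedBall_zero_iff.1 hz)
      have h2 : 0 < ‖z - ζ‖ := norm_pos_iff.2 (sub_ne_zero.2 hne)
      simp only [peakFun_self hζ, norm_one, one_pow]
      have : 0 < ‖z - ζ‖ ^ 2 := by positivity
      linarith)
    (fun z _ => sq_nonneg _) (by simp [peakFun_self hζ]) (by simp [hζ]) hg.integrableOn hgc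
  rw [hrestr] at h
  refine h.congr fun k => ?_
  rw [← integral_smul]
  refine integral_congr_ae ?_
  filter_upwards [norm_peakVec_sq_ae n hζ k] with z hz
  rw [hz, mul_smul]

theorem tendsto_inner_peakVec (n : ℕ) {ζ : Cd d} (hζ : ‖ζ‖ = 1) (y : Bergman d n) :
    Tendsto (fun k => ⟪y, peakVec n hζ k⟫_ℂ) atTop (𝓝 0) := by
  have hpos (m : ℕ) : (0 : ℝ) < 1 / (m + 1) := by positivity
  refine tendsto_inner_of_concentrating (x := fun k => incl d n (peakVec n hζ k))
    (norm_peakVec_le_one n hζ) (U := fun m => Metric.ball ζ (1 / (m + 1)))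
    (fun m => Metric.isOpen_ball.measurableSet) (fun m m' h => Metric.ball_subset_ball ?_) ?_
    (fun m => ?_) (incl d n y)
  · exact one_div_le_one_div_of_le (by positivity) (by gcongr)
  · refine measure_mono_null (t := (Metric.ball (0 : Cd d) 1)ᶜ) (fun z hz => ?_) (ae_mem_ball d n)
    have : z = ζ := by
      rw [← dist_le_zero]
      refine le_of_forall_gt_imp_ge_of_dense fun ε hε => ?_
      obtain ⟨m, hm⟩ := exists_nat_one_div_lt hε
      exact ((Metric.mem_ball.1 (Set.mem_iInter.1 hz m)).trans hm).le
    simp [this, hζ]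
  · have hU : MeasurableSet (Metric.ball ζ (1 / ((m : ℝ) + 1)))ᶜ :=
      Metric.isOpen_ball.measurableSet.compl
    have h := tendsto_integral_peakVec n hζ
      (g := (Metric.ball ζ (1 / ((m : ℝ) + 1)))ᶜ.indicator fun _ => (1 : ℝ))
      ((integrable_const _).indicator hU) (by
        refine ContinuousAt.continuousWithinAt ?_
        refine (continuousAt_const (y := (0 : ℝ))).congr ?_
        filter_upwards [Metric.ball_mem_nhds ζ (hpos m)] with z hz
        simp only [Set.indicator_of_notMem (Set.notMem_compl_iff.2 hz)])
    rw [Set.indicator_of_notMem (Set.notMem_compl_iff.2 (Metric.mem_ball_self (hpos m)))] at h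
    refine h.congr fun k => ?_
    rw [← integral_indicator hU]
    congr 1
    ext z
    by_cases hz : z ∈ (Metric.ball ζ (1 / ((m : ℝ) + 1)))ᶜ
    · simp only [Set.indicator_of_mem hz, smul_eq_mul, mul_one]
    · simp only [Set.indicator_of_notMem hz, smul_eq_mul, mul_zero]

theorem inner_toeplitz (n : ℕ) (u : C(CBall d, ℂ)) (x : Bergman d n) :
    ⟪x, toeplitz n u x⟫_ℂ = ∫ z, ‖incl d n x z‖ ^ 2 • extendZero u z ∂ballMeasure d n := by
  have h1 : ⟪x, toeplitz n u x⟫_ℂ = ⟪incl d n x, mulOp n u (incl d n x)⟫_ℂ :=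
    Submodule.inner_orthogonalProjectionOnto_eq_of_mem_left (K := bergman d n) x _
  rw [h1, L2.inner_def]
  refine integral_congr_ae ?_
  have h2 : mulOp n u (incl d n x) =ᵐ[ballMeasure d n] fun z =>
      ((memLp_extendZero n u).toLp _ : Lp ℂ ∞ (ballMeasure d n)) z * incl d n x z :=
    (ContinuousLinearMap.mul ℂ ℂ).coeFn_holder _ _
  filter_upwards [h2, (memLp_extendZero n u).coeFn_toLp] with z hz hz'
  rw [hz, hz', RCLike.inner_apply, mul_assoc, Complex.mul_conj, Complex.normSq_eq_norm_sq, mul_comm]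
  rfl

theorem tendsto_inner_toeplitz (n : ℕ) {ζ : Cd d} (hζ : ‖ζ‖ = 1) (u : C(CBall d, ℂ)) :
    Tendsto (fun k => ⟪peakVec n hζ k, toeplitz n u (peakVec n hζ k)⟫_ℂ) atTop
      (𝓝 (extendZero u ζ)) := by
  simp only [inner_toeplitz]
  refine tendsto_integral_peakVec n hζ ((memLp_extendZero n u).integrable le_top) ?_
  have hc : ContinuousOn (extendZero u) (Metric.closedBall 0 1) := by
    rw [continuousOn_iff_continuous_domRestrict]
    convert u.continuous using 1
    ext z
    simp [extendZero]
  exact hc ζ (by simp [hζ])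

/-- The symbol of an operator is recovered from its expectations in the normalized powers of
peak functions. -/
theorem HasSymbol.tendsto_inner {n : ℕ} {T : Bergman d n →L[ℂ] Bergman d n} {f : C(Sph d, ℂ)}
    (h : HasSymbol T f) (ζ : Sph d) (hζ : ‖ζ.1‖ = 1) :
    Tendsto (fun k => ⟪peakVec n hζ k, T (peakVec n hζ k)⟫_ℂ) atTop (𝓝 (f ζ)) := by
  obtain ⟨u, K, hK, rfl, rfl⟩ := h
  have h1 := tendsto_inner_toeplitz n hζ u
  have h2 := (tendsto_inner_of_isCompactOperator hK (norm_peakVec_le_one n hζ)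
    (tendsto_inner_peakVec n hζ)).star
  have h3 : extendZero u ζ.1 = restrictSphere u ζ :=
    dif_pos (Metric.sphere_subset_closedBall ζ.2)
  rw [star_zero] at h2
  have h4 := h1.add h2
  rw [add_zero, h3] at h4
  refine h4.congr fun k => ?_
  rw [add_apply, inner_add_right]
  congr 1
  exact inner_conj_symm _ _

end Peak

/-! ### The symbol map on `Lip(𝒯_n)` -/

section Symbol

variable {d n : ℕ} (e : HilbertBasis ℕ ℂ (Bergman d n)) (σ : PositiveSplitting d n)

variable {σ} in
theorem PositiveSplitting.hasSymbol_op_add (f : C(Sph d, ℝ)) {K : Bergman d n →L[ℂ] Bergman d n}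
    (hK : IsCompactOperator K) : HasSymbol (σ.op f + K) (complexify f) := by
  obtain ⟨u, K', hK', h, hu⟩ := σ.splits (complexify f)
  exact ⟨u, K' + K, hK'.add hK, by rw [PositiveSplitting.op, h, add_assoc], hu⟩

theorem HasSymbol.unique {T : Bergman d n →L[ℂ] Bergman d n} {f g : C(Sph d, ℂ)}
    (hf : HasSymbol T f) (hg : HasSymbol T g) : f = g := by
  ext ζ
  have hζ : ‖ζ.1‖ = 1 := by simp
  exact tendsto_nhds_unique (hf.tendsto_inner ζ hζ) (hg.tendsto_inner ζ hζ)

theorem HasSymbol.nonneg_of_isPositive {T : Bergman d n →L[ℂ] Bergman d n} {f : C(Sph d, ℝ)}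
    (h : HasSymbol T (complexify f)) (hT : T.IsPositive) (ζ : Sph d) : 0 ≤ f ζ := by
  have hζ : ‖ζ.1‖ = 1 := by simp
  have h1 := (Complex.continuous_re.tendsto _).comp (h.tendsto_inner ζ hζ)
  exact ge_of_tendsto' h1 fun k => hT.re_inner_nonneg_right _

variable {σ} in
theorem eq_of_op_add_eq {f g : LipFun (Sph d)} {K K' : Bergman d n →L[ℂ] Bergman d n}
    (hK : IsCompactOperator K) (hK' : IsCompactOperator K')
    (h : σ.op f.1 + K = σ.op g.1 + K') : f = g := by
  have h1 := (σ.hasSymbol_op_add f.1 hK).unique (h ▸ σ.hasSymbol_op_add g.1 hK')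
  ext ζ
  have h2 : ((f.1 ζ : ℝ) : ℂ) = ((g.1 ζ : ℝ) : ℂ) := DFunLike.congr_fun h1 ζ
  exact_mod_cast h2

/-- The symbol of an element of `Lip(𝒯_n)`, characterized by `symbol_eq`. -/
noncomputable def symbol (T : lipToeplitz e σ) : LipFun (Sph d) := T.2.choose

theorem sub_op_symbol_mem (T : lipToeplitz e σ) :
    T.1 - σ.op (symbol e σ T).1 ∈ lipCompact (n + 2) e := by
  obtain ⟨K, hK, h⟩ := T.2.choose_spec
  have : T.1 - σ.op (symbol e σ T).1 = K := sub_eq_of_eq_add' h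
  rwa [this]

variable {e σ} in
theorem symbol_eq {T : lipToeplitz e σ} {f : LipFun (Sph d)}
    {K : Bergman d n →L[ℂ] Bergman d n} (hK : K ∈ lipCompact (n + 2) e)
    (h : T.1 = σ.op f.1 + K) : symbol e σ T = f :=
  eq_of_op_add_eq (sub_op_symbol_mem e σ T).1 hK.1 ((add_sub_cancel _ _).trans h)

/-- The symbol map `σ(f) + K ↦ f`. -/
noncomputable def symbolMap : lipToeplitz e σ →ₗ[ℝ] LipFun (Sph d) where
  toFun := symbol e σ
  map_add' S T := symbol_eq (add_mem (sub_op_symbol_mem e σ S) (sub_op_symbol_mem e σ T)) (by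
    rw [show (symbol e σ S + symbol e σ T).1 = (symbol e σ S).1 + (symbol e σ T).1 from rfl,
      σ.op_add, show (S + T).1 = S.1 + T.1 from rfl]
    abel)
  map_smul' r T := symbol_eq (Submodule.smul_mem _ r (sub_op_symbol_mem e σ T)) (by
    rw [RingHom.id_apply, show (r • symbol e σ T).1 = r • (symbol e σ T).1 from rfl,
      σ.op_smul, smul_sub, add_sub_cancel]
    rfl)

/-- The splitting `f ↦ σ(f)`, restricted to Lipschitz functions. -/
noncomputable def lipSection : LipFun (Sph d) →ₗ[ℝ] lipToeplitz e σ where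
  toFun f := ⟨σ.op f.1, f, 0, zero_mem _, (add_zero _).symm⟩
  map_add' f g := Subtype.ext (σ.op_add f.1 g.1)
  map_smul' r f := Subtype.ext (σ.op_smul r f.1)

theorem symbolMap_lipSection (f : LipFun (Sph d)) : symbolMap e σ (lipSection e σ f) = f :=
  symbol_eq (zero_mem _) (add_zero _).symm

theorem lipSection_one : lipSection e σ lipOne = toeplitzOne e σ :=
  Subtype.ext σ.op_one

theorem symbolMap_one : symbolMap e σ (toeplitzOne e σ) = lipOne := by
  rw [← lipSection_one, symbolMap_lipSection]

theorem lipSection_nonneg (f : LipFun (Sph d)) (hf : 0 ≤ f) : 0 ≤ lipSection e σ f :=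
  (ContinuousLinearMap.nonneg_iff_isPositive _).2 (σ.positive f.1 hf)

/-- Positivity modulo compact operators is detected by the symbol. -/
theorem symbolMap_nonneg (T : lipToeplitz e σ) (hT : 0 ≤ T) : 0 ≤ symbolMap e σ T := by
  have h1 : HasSymbol T.1 (complexify (symbol e σ T).1) := by
    have := σ.hasSymbol_op_add (symbol e σ T).1 (sub_op_symbol_mem e σ T).1
    rwa [add_sub_cancel] at this
  exact h1.nonneg_of_isPositive ((ContinuousLinearMap.nonneg_iff_isPositive _).1 hT)

/-- The decomposition `σ(f) + K` being unique, the infimum in `toeplitzSeminorm` is over a single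
value. -/
theorem toeplitzSeminorm_eq (T : lipToeplitz e σ) :
    toeplitzSeminorm e σ T = compactSeminorm (n + 2) e (T.1 - σ.op (symbolMap e σ T).1) +
      lipSeminorm (symbolMap e σ T) := by
  rw [toeplitzSeminorm]
  refine (congrArg sInf (Set.ext fun r => ⟨?_, ?_⟩)).trans (csInf_singleton _)
  · rintro ⟨f, K, hK, h, rfl⟩
    have h1 : symbolMap e σ T = f := symbol_eq hK h
    rw [h1, sub_eq_of_eq_add' h]
    rfl
  · rintro rfl
    exact ⟨_, _, sub_op_symbol_mem e σ T, (add_sub_cancel _ _).symm, rfl⟩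

/-! ### `Lip(𝒯_n)` as a compact quantum metric space -/

/-- `σ(f)` differs from the positive operator `σ(f + ‖f‖)` by a real scalar. -/
theorem isSelfAdjoint_op (f : C(Sph d, ℝ)) : IsSelfAdjoint (σ.op f) := by
  have h1 : IsSelfAdjoint (σ.op (f + ‖f‖ • 1)) := by
    refine (σ.positive _ fun x => ?_).isSelfAdjoint
    have h := neg_le_of_abs_le (f.norm_coe_le_norm x)
    change 0 ≤ f x + ‖f‖ * 1
    linarith
  rw [σ.op_add, σ.op_smul, σ.op_one] at h1
  have h2 := h1.sub ((IsSelfAdjoint.all ‖f‖).smul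
    (IsSelfAdjoint.one (Bergman d n →L[ℂ] Bergman d n)))
  rwa [add_sub_cancel_right] at h2

theorem isSelfAdjoint_of_lipToeplitz (T : lipToeplitz e σ) : IsSelfAdjoint T.1 := by
  obtain ⟨T, f, K, hK, rfl⟩ := T
  exact (isSelfAdjoint_op σ f.1).add hK.2.1

variable {e σ} in
theorem orderBounded_toeplitzOne {T : lipToeplitz e σ} {ε : ℝ} (h : ‖T.1‖ ≤ ε) :
    OrderBounded (toeplitzOne e σ) ε T := by
  have hle : ∀ S : Bergman d n →L[ℂ] Bergman d n, IsSelfAdjoint S → ‖S‖ ≤ ε →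
      0 ≤ ε • (1 : Bergman d n →L[ℂ] Bergman d n) - S := fun S hS hSε => by
    have h1 := hS.le_algebraMap_norm_self
    rw [Algebra.algebraMap_eq_smul_one] at h1
    refine sub_nonneg.2 (h1.trans ?_)
    rw [← sub_nonneg, ← sub_smul]
    exact smul_nonneg (sub_nonneg.2 hSε) zero_le_one
  have hT := isSelfAdjoint_of_lipToeplitz e σ T
  refine ⟨hle T.1 hT h, ?_⟩
  have h2 := hle (-T.1) hT.neg (by rwa [norm_neg])
  rw [sub_neg_eq_add] at h2
  exact h2

theorem isOrderUnitSpace_lipToeplitz : IsOrderUnitSpace (toeplitzOne e σ) where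
  add_le_add S T R h := by
    change S.1 + R.1 ≤ T.1 + R.1
    gcongr
  smul_nonneg r T hr hT := by
    have hT' : 0 ≤ T.1 := hT
    exact (smul_nonneg hr hT' : 0 ≤ r • T.1)
  unit_nonneg := (zero_le_one : (0 : Bergman d n →L[ℂ] Bergman d n) ≤ 1)
  order_unit T := ⟨‖T.1‖, by
    have h : 0 ≤ ‖T.1‖ • (1 : Bergman d n →L[ℂ] Bergman d n) - T.1 :=
      (orderBounded_toeplitzOne (le_refl ‖T.1‖)).1
    exact sub_nonneg.1 h⟩
  archimedean T h := by
    have h1 : ∀ r : ℝ, 0 < r → T.1 ≤ r • (1 : Bergman d n →L[ℂ] Bergman d n) := h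
    change T.1 ≤ 0
    have h2 : Tendsto (fun r : ℝ => r • (1 : Bergman d n →L[ℂ] Bergman d n)) (𝓝[>] 0)
        (𝓝 ((0 : ℝ) • 1)) :=
      ((continuous_id.smul continuous_const).tendsto 0).mono_left nhdsWithin_le_nhds
    rw [zero_smul] at h2
    exact ge_of_tendsto h2 (eventually_mem_nhdsWithin.mono h1)

theorem sub_lipSection_norm_le (T : lipToeplitz e σ) :
    ‖(T - lipSection e σ (symbolMap e σ T)).1‖ ≤ toeplitzSeminorm e σ T * (1 / 2) ^ n *
      Real.sqrt (∑' p, entryWeight p ^ 2) := by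
  refine (norm_le_compactSeminorm (sub_op_symbol_mem e σ T)).trans ?_
  gcongr
  rw [toeplitzSeminorm_eq]
  exact le_add_of_nonneg_right (lipSeminorm_nonneg _)

theorem lipSeminorm_symbolMap_le (T : lipToeplitz e σ) :
    lipSeminorm (symbolMap e σ T) ≤ toeplitzSeminorm e σ T := by
  rw [toeplitzSeminorm_eq]
  exact le_add_of_nonneg_left (compactSeminorm_nonneg _ _ _)

theorem toeplitzSeminorm_lipSection (f : LipFun (Sph d)) :
    toeplitzSeminorm e σ (lipSection e σ f) = lipSeminorm f := by
  rw [toeplitzSeminorm_eq, symbolMap_lipSection]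
  have h1 : (lipSection e σ f).1 - σ.op f.1 = (0 : ℝ) • (0 : Bergman d n →L[ℂ] Bergman d n) := by
    rw [smul_zero]
    exact sub_self _
  rw [h1, compactSeminorm_smul, abs_zero, zero_mul, zero_add]

theorem hasFiniteNets_toeplitzSeminorm [Nonempty (Sph d)] :
    HasFiniteNets (toeplitzOne e σ) (toeplitzSeminorm e σ) := by
  classical
  intro ε hε
  have hA := isOrderUnitSpace_lipToeplitz e σ
  obtain ⟨F, hF⟩ := hasFiniteNets_lipFun (X := Sph d) (ε / 2) (half_pos hε)
  obtain ⟨G, hGmem, hG⟩ := exists_finset_lipCompact n e (half_pos hε)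
  let ι : lipCompact (n + 2) e → lipToeplitz e σ := fun K =>
    ⟨K.1, 0, K.1, K.2, by
      rw [show (0 : LipFun (Sph d)).1 = (0 : ℝ) • (1 : C(Sph d, ℝ)) from (zero_smul _ _).symm,
        σ.op_smul, zero_smul, zero_add]⟩
  refine ⟨(F ×ˢ G.attach).image fun p =>
    lipSection e σ p.1 + ι ⟨p.2.1, hGmem _ p.2.2⟩, fun T hT => ?_⟩
  have hf := (lipSeminorm_symbolMap_le e σ T).trans hT
  have hK : compactSeminorm (n + 2) e (T.1 - σ.op (symbolMap e σ T).1) ≤ 1 := by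
    rw [toeplitzSeminorm_eq] at hT
    linarith [lipSeminorm_nonneg (symbolMap e σ T)]
  obtain ⟨f, hfF, r, hr⟩ := hF _ hf
  obtain ⟨K, hKG, hKε⟩ := hG _ (sub_op_symbol_mem e σ T) hK
  refine ⟨_, Finset.mem_image_of_mem _ (Finset.mk_mem_product hfF (Finset.mem_attach _ ⟨K, hKG⟩)),
    r, ?_⟩
  have h1 := hr.map (lipSection_nonneg e σ) (lipSection_one e σ)
  have h2 : OrderBounded (toeplitzOne e σ) (ε / 2)
      (T - lipSection e σ (symbolMap e σ T) - ι ⟨K, hGmem _ hKG⟩) :=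
    orderBounded_toeplitzOne hKε
  have h3 := (h1.add hA h2).mono hA (add_halves ε).le
  convert h3 using 1
  simp only [map_sub, map_smul, lipSection_one]
  abel

theorem isLipNorm_toeplitzSeminorm [Nonempty (Sph d)] :
    IsLipNorm (toeplitzOne e σ) (toeplitzSeminorm e σ) := by
  refine .of_hasFiniteNets (fun S T => ?_) (fun r T => ?_) ?_ (hasFiniteNets_toeplitzSeminorm e σ)
  · have h : (S + T).1 - σ.op (symbolMap e σ (S + T)).1 =
        (S.1 - σ.op (symbolMap e σ S).1) + (T.1 - σ.op (symbolMap e σ T).1) := by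
      rw [map_add, show (symbolMap e σ S + symbolMap e σ T).1 = (symbolMap e σ S).1 +
        (symbolMap e σ T).1 from rfl, σ.op_add, show (S + T).1 = S.1 + T.1 from rfl]
      abel
    rw [toeplitzSeminorm_eq, toeplitzSeminorm_eq, toeplitzSeminorm_eq, h, map_add]
    have h1 := compactSeminorm_add_le (sub_op_symbol_mem e σ S) (sub_op_symbol_mem e σ T)
    have h2 := lipSeminorm_add_le (symbolMap e σ S) (symbolMap e σ T)
    exact (add_le_add h1 h2).trans_eq (add_add_add_comm _ _ _ _)
  · have h : (r • T).1 - σ.op (symbolMap e σ (r • T)).1 =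
        r • (T.1 - σ.op (symbolMap e σ T).1) := by
      rw [map_smul, show (r • symbolMap e σ T).1 = r • (symbolMap e σ T).1 from rfl,
        σ.op_smul, smul_sub]
      rfl
    rw [toeplitzSeminorm_eq, toeplitzSeminorm_eq, h, map_smul, compactSeminorm_smul,
      lipSeminorm_smul, mul_add]
  · rw [← lipSection_one, toeplitzSeminorm_lipSection, lipSeminorm_one]

theorem quantumGHDist_toeplitz_le [Nonempty (Sph d)] :
    quantumGHDist (toeplitzOne e σ) (toeplitzSeminorm e σ) (lipOne : LipFun (Sph d)) lipSeminorm ≤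
      ENNReal.ofReal (2 * ((1 / 2) ^ n * Real.sqrt (∑' p, entryWeight p ^ 2))) := by
  have hS : 0 < ∑' p, entryWeight p ^ 2 :=
    summable_entryWeight_sq.tsum_pos (fun p => sq_nonneg _) (0, 0) (pow_pos (entryWeight_pos _) 2)
  refine quantumGHDist_le_of_section (π := symbolMap e σ) (τ := lipSection e σ) (by positivity)
    (isOrderUnitSpace_lipToeplitz e σ) (isLipNorm_toeplitzSeminorm e σ)
    (hasFiniteNets_toeplitzSeminorm e σ) (symbolMap_one e σ) (symbolMap_nonneg e σ)
    (lipSection_one e σ) (lipSection_nonneg e σ) (symbolMap_lipSection e σ)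
    (fun f => (toeplitzSeminorm_lipSection e σ f).le) (lipSeminorm_symbolMap_le e σ)
    fun T hT => orderBounded_toeplitzOne ((sub_lipSection_norm_le e σ T).trans ?_)
  rw [mul_assoc]
  exact mul_le_of_le_one_left (by positivity) hT

end Symbol

end QuantumSphere

open QuantumSphere in
theorem theorem3p1 (d : ℕ) (hd : 1 ≤ d)
    (e : ∀ n : Set.Ici d, HilbertBasis ℕ ℂ (Bergman d n))
    (σ : ∀ n : Set.Ici d, PositiveSplitting d n) :
    (∀ n : Set.Ici d, IsCompactQuantumMetricSpace (toeplitzOne (e n) (σ n))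
      (toeplitzSeminorm (e n) (σ n))) ∧
    IsCompactQuantumMetricSpace (lipOne : LipFun (Sph d)) lipSeminorm ∧
    Filter.Tendsto (fun n : Set.Ici d =>
      quantumGHDist (toeplitzOne (e n) (σ n)) (toeplitzSeminorm (e n) (σ n))
        (lipOne : LipFun (Sph d)) lipSeminorm) Filter.atTop (nhds 0) := by
  have : Nonempty (Fin d) := ⟨⟨0, hd⟩⟩
  have : Nonempty (Sph d) := (NormedSpace.sphere_nonempty (E := Cd d)).2 zero_le_one |>.to_subtype
  refine ⟨fun n => ⟨isOrderUnitSpace_lipToeplitz _ _, isLipNorm_toeplitzSeminorm _ _⟩,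
    isCompactQuantumMetricSpace_lipFun, ?_⟩
  refine tendsto_of_tendsto_of_tendsto_of_le_of_le tendsto_const_nhds ?_ (fun _ => zero_le)
    fun n => quantumGHDist_toeplitz_le (e n) (σ n)
  have h1 : Tendsto (fun n : ℕ => ENNReal.ofReal (2 * ((1 / 2 : ℝ) ^ n *
      Real.sqrt (∑' p, entryWeight p ^ 2)))) atTop (𝓝 0) := by
    have h := (((tendsto_pow_atTop_nhds_zero_of_lt_one (r := (1 / 2 : ℝ)) (by norm_num)
      (by norm_num)).mul_const (Real.sqrt (∑' p, entryWeight p ^ 2))).const_mul 2)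
    have := (ENNReal.continuous_ofReal.tendsto _).comp h
    simpa [Function.comp_def] using this
  exact h1.comp (tendsto_comp_val_Ici_atTop.2 tendsto_id)
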